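/- Let $\mathbb P^1=\operatorname{Proj}\mathbb C[x,y]$. For $(a,b,c)\in\mathbb C^3$ let $$M_{a,b,c}=\begin{pmatrix}a&b&c\\x&0&0\\y&x&0\\0&y&x\\0&0&y\end{pmatrix}:\ \mathcal O(-2)^{\oplus3}\longrightarrow\mathcal O(-2)\oplus\mathcal O(-1)^{\oplus4},$$ and let $\mathcal E_{a,b,c}=\operatorname{coker}M_{a,b,c}$. Then $M_{a,b,c}$ is injective, and the inclusion of the summand $\mathcal O(-2)$ together with the map $\mathcal E_{a,b,c}\to\mathcal O(2)$ induced by $(0,\,y^3,\,-xy^2,\,x^2y,\,-x^3)$ gives a short exact sequence $$0\to\mathcal O(-2)\to\mathcal E_{a,b,c}\to\mathcal O(2)\to0 .$$ The map sending $(a,b,c)$ to the class of this extension is an isomorphism of complex vector spaces $\mathbb C^3\cong\operatorname{Ext}^1(\mathcal O(2),\mathcal O(-2))$. Moreover, for every extension $0\to\mathcal O(-2)\to\mathcal E\to\mathcal O(2)\to0$ of sheaves of $\mathcal O_{\mathbb P^1}$-modules whose class corresponds to $(a,b,c)$ under this isomorphism, $$\mathcal E\cong\begin{cases}\mathcal O(-2)\oplus\mathcal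 O(2)&\text{if }a=b=c=0,\\ \mathcal O(-1)\oplus\mathcal O(1)&\text{if }(a,b,c)\neq(0,0,0)\text{ and }b^2-ac=0,\\ \mathcal O\oplus\mathcal O&\text{otherwise.}\end{cases}$$ -/

import Mathlib

open AlgebraicGeometry CategoryTheory CategoryTheory.Limits TopologicalSpace Opposite

namespace P1Ext
noncomputable section

variable {X : Scheme.{0}}

/-- Restriction of sections of the structure sheaf from `W` to a smaller open set `V`. -/
def res {V W : X.Opens} (h : V ≤ W) : Γ(X, W) →+* Γ(X, V) :=
  (X.presheaf.map (homOfLE h).op).hom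

lemma res_res {U V W : X.Opens} (h : U ≤ V) (h' : V ≤ W) (s : Γ(X, W)) :
    res h (res h' s) = res (h.trans h') s := by
  simp only [res, ← CommRingCat.comp_apply, ← Functor.map_comp, ← op_comp]
  rfl

lemma res_self {U : X.Opens} (h : U ≤ U) (s : Γ(X, U)) : res h s = s := by
  have : (homOfLE h).op = 𝟙 (op U) := rfl
  simp [res]

variable (U₀ U₁ : X.Opens) (g : Γ(X, U₀ ⊓ U₁)ˣ)

/-- Sections over `U` of the sheaf obtained by gluing the structure sheaves of `U₀` and `U₁`
along `g`: pairs of functions `s₀` on `U ⊓ U₀`, `s₁` on `U ⊓ U₁` with `s₁ = g s₀` on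
`U ⊓ U₀ ⊓ U₁`. -/
def glueSections (U : X.Opens) : AddSubgroup (Γ(X, U ⊓ U₀) × Γ(X, U ⊓ U₁)) where
  carrier := {s | res (le_inf inf_le_left (inf_le_right.trans inf_le_right) :
      U ⊓ (U₀ ⊓ U₁) ≤ U ⊓ U₁) s.2 = res (inf_le_right : U ⊓ (U₀ ⊓ U₁) ≤ U₀ ⊓ U₁) g *
        res (le_inf inf_le_left (inf_le_right.trans inf_le_left) :
          U ⊓ (U₀ ⊓ U₁) ≤ U ⊓ U₀) s.1}
  add_mem' {s s'} h h' := by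
    simp only [Set.mem_ofPred_eq, Prod.fst_add, Prod.snd_add, map_add] at h h' ⊢
    rw [h, h', mul_add]
  zero_mem' := by simp
  neg_mem' {s} h := by
    simp only [Set.mem_ofPred_eq, Prod.fst_neg, Prod.snd_neg, map_neg] at h ⊢
    rw [h, mul_neg]

variable {U₀ U₁ g}

lemma mem_glueSections {U : X.Opens} {s : Γ(X, U ⊓ U₀) × Γ(X, U ⊓ U₁)} :
    s ∈ glueSections U₀ U₁ g U ↔
      res (le_inf inf_le_left (inf_le_right.trans inf_le_right) :
        U ⊓ (U₀ ⊓ U₁) ≤ U ⊓ U₁) s.2 =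
      res (inf_le_right : U ⊓ (U₀ ⊓ U₁) ≤ U₀ ⊓ U₁) g *
        res (le_inf inf_le_left (inf_le_right.trans inf_le_left) :
          U ⊓ (U₀ ⊓ U₁) ≤ U ⊓ U₀) s.1 := Iff.rfl

lemma glueSections_ext {U : X.Opens} {s s' : glueSections U₀ U₁ g U}
    (h₀ : s.1.1 = s'.1.1) (h₁ : s.1.2 = s'.1.2) : s = s' :=
  Subtype.ext (Prod.ext h₀ h₁)

instance (U : X.Opens) : SMul Γ(X, U) (glueSections U₀ U₁ g U) where
  smul r s := ⟨(res inf_le_left r * s.1.1, res inf_le_left r * s.1.2), by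
    have := s.2
    simp only [glueSections, AddSubgroup.mem_mk, AddSubmonoid.mem_mk, AddSubsemigroup.mem_mk,
      Set.mem_ofPred_eq, map_mul, res_res] at this ⊢
    rw [this, mul_left_comm]⟩

lemma smul_fst {U : X.Opens} (r : Γ(X, U)) (s : glueSections U₀ U₁ g U) :
    (r • s).1.1 = res inf_le_left r * s.1.1 := rfl

lemma smul_snd {U : X.Opens} (r : Γ(X, U)) (s : glueSections U₀ U₁ g U) :
    (r • s).1.2 = res inf_le_left r * s.1.2 := rfl

instance (U : X.Opens) : Module Γ(X, U) (glueSections U₀ U₁ g U) where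
  one_smul s := glueSections_ext (by simp [smul_fst]) (by simp [smul_snd])
  mul_smul r r' s := glueSections_ext (by simp [smul_fst, mul_assoc]) (by simp [smul_snd, mul_assoc])
  smul_zero r := glueSections_ext (by simp [smul_fst]) (by simp [smul_snd])
  zero_smul r := glueSections_ext (by simp [smul_fst]) (by simp [smul_snd])
  smul_add r s s' := glueSections_ext (by simp [smul_fst, mul_add]) (by simp [smul_snd, mul_add])
  add_smul r r' s := glueSections_ext (by simp [smul_fst, add_mul]) (by simp [smul_snd, add_mul])

/-- Componentwise restriction of a glued section. -/
def glueRes {V U : X.Opens} (h : V ≤ U) : glueSections U₀ U₁ g U →+ glueSections U₀ U₁ g V where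
  toFun s := ⟨(res (inf_le_inf_right _ h) s.1.1, res (inf_le_inf_right _ h) s.1.2), by
    have := congrArg (res (inf_le_inf_right (U₀ ⊓ U₁) h)) s.2
    simp only [glueSections, AddSubgroup.mem_mk, AddSubmonoid.mem_mk, AddSubsemigroup.mem_mk,
      Set.mem_ofPred_eq, map_mul, res_res] at this ⊢
    exact this⟩
  map_zero' := glueSections_ext (by simp) (by simp)
  map_add' s s' := glueSections_ext (by simp) (by simp)

variable (U₀ U₁ g)

/-- The presheaf of abelian groups `U ↦ glueSections U₀ U₁ g U`. -/
def gluePresheaf : TopCat.Presheaf Ab X where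
  obj U := AddCommGrpCat.of (glueSections U₀ U₁ g U.unop)
  map i := AddCommGrpCat.ofHom (glueRes i.unop.le)
  map_id U := AddCommGrpCat.hom_ext (AddMonoidHom.ext fun (s : glueSections U₀ U₁ g U.unop) ↦
    glueSections_ext (res_self _ s.1.1) (res_self _ s.1.2))
  map_comp i j := AddCommGrpCat.hom_ext (AddMonoidHom.ext fun s ↦
    glueSections_ext (s := glueRes (j.unop.le.trans i.unop.le) s)
      (s' := glueRes j.unop.le (glueRes i.unop.le s)) (res_res _ _ _).symm (res_res _ _ _).symm)

instance (U : (TopologicalSpace.Opens X)ᵒᵖ) :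
    Module (X.ringCatSheaf.obj.obj U) ((gluePresheaf U₀ U₁ g).obj U) :=
  inferInstanceAs (Module Γ(X, U.unop) (glueSections U₀ U₁ g U.unop))

lemma gluePresheaf_map_smul ⦃U V : (TopologicalSpace.Opens X)ᵒᵖ⦄ (i : U ⟶ V)
    (r : X.ringCatSheaf.obj.obj U) (s : (gluePresheaf U₀ U₁ g).obj U) :
    (gluePresheaf U₀ U₁ g).map i (r • s) =
      X.ringCatSheaf.obj.map i r • (gluePresheaf U₀ U₁ g).map i s := by
  refine glueSections_ext ((map_mul _ _ _).trans ?_) ((map_mul _ _ _).trans ?_)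
  · refine congrArg (· * _) ((res_res _ _ _).trans (res_res _ i.unop.le _).symm)
  · refine congrArg (· * _) ((res_res _ _ _).trans (res_res _ i.unop.le _).symm)

lemma gluePresheaf_isSheaf : (gluePresheaf U₀ U₁ g).IsSheaf := by
  rw [TopCat.Presheaf.isSheaf_iff_isSheafUniqueGluing]
  intro ι U sf hsf
  have H (W : X.Opens) (t : ∀ i, Γ(X, U i ⊓ W))
      (ht : ∀ i j, res (inf_le_inf_right W (inf_le_left : U i ⊓ U j ≤ U i)) (t i) =
        res (inf_le_inf_right W (inf_le_right : U i ⊓ U j ≤ U j)) (t j)) :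
      ∃! s : Γ(X, iSup U ⊓ W), ∀ i, res (inf_le_inf_right W (le_iSup U i)) s = t i := by
    refine X.sheaf.existsUnique_gluing' (fun i ↦ U i ⊓ W) (iSup U ⊓ W)
      (fun i ↦ homOfLE (inf_le_inf_right W (le_iSup U i))) (by rw [iSup_inf_eq]) t ?_
    intro i j
    have h : (U i ⊓ W) ⊓ (U j ⊓ W) ≤ U i ⊓ U j ⊓ W :=
      le_inf (le_inf (inf_le_left.trans inf_le_left) (inf_le_right.trans inf_le_left))
        (inf_le_left.trans inf_le_right)
    have := congrArg (res h) (ht i j)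
    rw [res_res, res_res] at this
    exact this
  obtain ⟨s₀, h₀, u₀⟩ := H U₀ (fun i ↦ (sf i).1.1) fun i j ↦ congrArg (fun s ↦ s.1.1) (hsf i j)
  obtain ⟨s₁, h₁, u₁⟩ := H U₁ (fun i ↦ (sf i).1.2) fun i j ↦ congrArg (fun s ↦ s.1.2) (hsf i j)
  refine ⟨⟨(s₀, s₁), ?_⟩, fun i ↦ glueSections_ext (h₀ i) (h₁ i), fun s hs ↦ glueSections_ext
    (u₀ _ fun i ↦ congrArg (fun s ↦ s.1.1) (hs i)) (u₁ _ fun i ↦ congrArg (fun s ↦ s.1.2) (hs i))⟩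
  refine X.sheaf.eq_of_locally_eq' (fun i ↦ U i ⊓ (U₀ ⊓ U₁)) _
    (fun i ↦ homOfLE (inf_le_inf_right _ (le_iSup U i))) (by rw [iSup_inf_eq]) _ _ fun i ↦ ?_
  have := (sf i).2
  simp only [glueSections, AddSubgroup.mem_mk, AddSubmonoid.mem_mk, AddSubsemigroup.mem_mk,
      Set.mem_ofPred_eq, ← h₀, ← h₁, res_res] at this
  change res (inf_le_inf_right _ (le_iSup U i)) _ = res (inf_le_inf_right _ (le_iSup U i)) _
  simp only [map_mul, res_res]
  exact this

/-- The sheaf of modules with transition function `g` between its trivialisations on `U₀`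
and `U₁`; it is a line bundle when `U₀` and `U₁` cover `X`. -/
def glue : X.Modules where
  val := PresheafOfModules.ofPresheaf (gluePresheaf U₀ U₁ g) (gluePresheaf_map_smul U₀ U₁ g)
  isSheaf := gluePresheaf_isSheaf U₀ U₁ g

variable {U₀ U₁ g}

/-- The map `(s₀, s₁) ↦ (a₀ s₀, a₁ s₁)` on sections over `U`. -/
def glueMul {g' : Γ(X, U₀ ⊓ U₁)ˣ} (a₀ : Γ(X, U₀)) (a₁ : Γ(X, U₁))
    (h : res (inf_le_right : U₀ ⊓ U₁ ≤ U₁) a₁ * (g : Γ(X, U₀ ⊓ U₁)) =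
      (g' : Γ(X, U₀ ⊓ U₁)) * res (inf_le_left : U₀ ⊓ U₁ ≤ U₀) a₀) (U : X.Opens) :
    glueSections U₀ U₁ g U →+ glueSections U₀ U₁ g' U where
  toFun s := ⟨(res inf_le_right a₀ * s.1.1, res inf_le_right a₁ * s.1.2), by
    have e := s.2
    have h' := congrArg (res (inf_le_right : U ⊓ (U₀ ⊓ U₁) ≤ _)) h
    rw [mem_glueSections] at e ⊢
    simp only [map_mul, res_res] at h' ⊢
    rw [e, ← mul_assoc, h', mul_assoc]⟩
  map_zero' := glueSections_ext (by simp) (by simp)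
  map_add' s s' := glueSections_ext (by simp [mul_add]) (by simp [mul_add])

/-- The morphism of sheaves of modules `(s₀, s₁) ↦ (a₀ s₀, a₁ s₁)`, for functions `a₀`, `a₁` on
`U₀`, `U₁` with `a₁ g = g' a₀` on the overlap. -/
def glueHom {g' : Γ(X, U₀ ⊓ U₁)ˣ} (a₀ : Γ(X, U₀)) (a₁ : Γ(X, U₁))
    (h : res (inf_le_right : U₀ ⊓ U₁ ≤ U₁) a₁ * (g : Γ(X, U₀ ⊓ U₁)) =
      (g' : Γ(X, U₀ ⊓ U₁)) * res (inf_le_left : U₀ ⊓ U₁ ≤ U₀) a₀) :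
    glue U₀ U₁ g ⟶ glue U₀ U₁ g' where
  val := PresheafOfModules.homMk (M₁ := (glue U₀ U₁ g).val) (M₂ := (glue U₀ U₁ g').val)
    { app U := AddCommGrpCat.ofHom (glueMul a₀ a₁ h U.unop)
      naturality U V i := AddCommGrpCat.hom_ext (AddMonoidHom.ext fun s ↦
        glueSections_ext (s := glueMul a₀ a₁ h V.unop (glueRes i.unop.le s))
          (s' := glueRes i.unop.le (glueMul a₀ a₁ h U.unop s))
          (by simp only [glueMul, glueRes, AddMonoidHom.coe_mk, ZeroHom.coe_mk, map_mul, res_res])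
          (by simp only [glueMul, glueRes, AddMonoidHom.coe_mk, ZeroHom.coe_mk, map_mul, res_res])) }
    fun U r s ↦ glueSections_ext (s := glueMul a₀ a₁ h U.unop
        ((show Γ(X, U.unop) from r) • (show glueSections U₀ U₁ g U.unop from s)))
      (s' := (show Γ(X, U.unop) from r) • glueMul a₀ a₁ h U.unop s)
      (mul_left_comm _ _ _) (mul_left_comm _ _ _)

/-- Multiplication by a global function, as an endomorphism of a sheaf of modules. -/
def globalSMul (r : Γ(X, ⊤)) (M : X.Modules) : M ⟶ M where
  val := PresheafOfModules.homMk
    { app U := AddCommGrpCat.ofHom (X := Γ(M, U.unop)) (Y := Γ(M, U.unop))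
        { toFun s := res le_top r • s
          map_zero' := smul_zero _
          map_add' s s' := smul_add _ _ _ }
      naturality U V i := by
        ext s
        refine Eq.trans ?_ (M.map_smul i.unop (res le_top r) s).symm
        exact congrArg (fun c : Γ(X, V.unop) ↦ (show Γ(M, V.unop) from c • (show Γ(M, V.unop) from M.presheaf.map i s)))
          (res_res i.unop.le le_top r).symm }
    fun U r s ↦ smul_comm (M := Γ(X, U.unop)) (N := Γ(X, U.unop)) (α := Γ(M, U.unop)) _ _ _

lemma globalSMul_app (r : Γ(X, ⊤)) (M : X.Modules) (U : X.Opens) (s : Γ(M, U)) :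
    (globalSMul r M).app U s = res (le_top : U ≤ ⊤) r • s := rfl

lemma comp_globalSMul {M N : X.Modules} (r : Γ(X, ⊤)) (f : M ⟶ N) :
    f ≫ globalSMul r N = globalSMul r M ≫ f := by
  ext U s
  exact (f.app_smul (res (le_top : U ≤ ⊤) r) s).symm

lemma globalSMul_one (M : X.Modules) : globalSMul 1 M = 𝟙 M := by
  ext U s
  refine (globalSMul_app _ _ _ s).trans ?_
  rw [map_one, one_smul]; rfl

lemma globalSMul_zero (M : X.Modules) : globalSMul 0 M = 0 := by
  ext U s
  refine (globalSMul_app _ _ _ s).trans ?_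
  rw [map_zero, zero_smul]; rfl

lemma globalSMul_add (r r' : Γ(X, ⊤)) (M : X.Modules) :
    globalSMul (r + r') M = globalSMul r M + globalSMul r' M := by
  ext U s
  refine (globalSMul_app _ _ _ s).trans ?_
  rw [map_add, add_smul]; rfl

lemma globalSMul_mul (r r' : Γ(X, ⊤)) (M : X.Modules) :
    globalSMul (r * r') M = globalSMul r' M ≫ globalSMul r M := by
  ext U s
  refine (globalSMul_app _ _ _ s).trans ?_
  rw [map_mul, mul_smul]; rfl

/-- For a scheme with a ring homomorphism `φ : k → Γ(X, 𝒪)`, the `k`-linear structure on the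
category of sheaves of modules: `r • f` is `f` followed by multiplication by `φ r`. -/
@[reducible]
def linearOfGlobal {k : Type} [CommRing k] (φ : k →+* Γ(X, ⊤)) : Linear k X.Modules where
  homModule M N :=
    { smul r f := f ≫ globalSMul (φ r) N
      one_smul f := by
        change f ≫ globalSMul (φ 1) N = f
        rw [map_one, globalSMul_one, Category.comp_id]
      mul_smul r r' f := by
        change f ≫ globalSMul (φ (r * r')) N = (f ≫ globalSMul (φ r') N) ≫ globalSMul (φ r) N
        rw [map_mul, globalSMul_mul, Category.assoc]
      smul_zero r := zero_comp
      smul_add r f f' := Preadditive.add_comp _ _ _ _ _ _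
      add_smul r r' f := by
        change f ≫ globalSMul (φ (r + r')) N = f ≫ globalSMul (φ r) N + f ≫ globalSMul (φ r') N
        rw [map_add, globalSMul_add, Preadditive.comp_add]
      zero_smul f := by
        change f ≫ globalSMul (φ 0) N = 0
        rw [map_zero, globalSMul_zero, comp_zero] }
  smul_comp M N K r f f' := by
    change (f ≫ globalSMul (φ r) N) ≫ f' = (f ≫ f') ≫ globalSMul (φ r) K
    rw [Category.assoc, Category.assoc, comp_globalSMul]
  comp_smul M N K f r f' := (Category.assoc _ _ _).symm

end

noncomputable section

attribute [local instance] MvPolynomial.gradedAlgebra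

/-- The grading of `ℂ[x, y]` by degree, where `x = X 0` and `y = X 1`. -/
abbrev homogPoly : ℕ → Submodule ℂ (MvPolynomial (Fin 2) ℂ) := MvPolynomial.homogeneousSubmodule (Fin 2) ℂ

/-- The complex projective line `Proj ℂ[x, y]`. -/
abbrev P1 : Scheme.{0} := Proj homogPoly

/-- The standard charts `D 0 = {x ≠ 0}` and `D 1 = {y ≠ 0}`. -/
abbrev D (i : Fin 2) : P1.Opens := Proj.basicOpen homogPoly (MvPolynomial.X i)

lemma X_mem (i : Fin 2) : (MvPolynomial.X i : MvPolynomial (Fin 2) ℂ) ∈ homogPoly 1 :=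
  MvPolynomial.isHomogeneous_X ℂ i

/-- The fraction `X j / X i` of degree zero. -/
def coordFrac (i j : Fin 2) :
    HomogeneousLocalization.Away homogPoly (MvPolynomial.X i : MvPolynomial (Fin 2) ℂ) :=
  HomogeneousLocalization.Away.mk homogPoly (X_mem i) 1 (MvPolynomial.X j) (X_mem j)

/-- The regular function `X j / X i` on `{X i ≠ 0}`. -/
def coordQuot (i j : Fin 2) : Γ(P1, D i) :=
  Proj.awayToSection homogPoly (MvPolynomial.X i) (coordFrac i j)

lemma coordFrac_mul (i j : Fin 2) :
    HomogeneousLocalization.awayMap homogPoly (X_mem j)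
        (rfl : MvPolynomial.X i * MvPolynomial.X j = _) (coordFrac i j) *
      HomogeneousLocalization.awayMap homogPoly (X_mem i)
        (mul_comm (MvPolynomial.X i) (MvPolynomial.X j)) (coordFrac j i) = 1 := by
  apply HomogeneousLocalization.val_injective
  rw [HomogeneousLocalization.val_mul, HomogeneousLocalization.val_one, coordFrac, coordFrac,
    HomogeneousLocalization.Away.mk, HomogeneousLocalization.Away.mk,
    HomogeneousLocalization.val_awayMap_mk, HomogeneousLocalization.val_awayMap_mk,
    Localization.mk_mul, ← Localization.mk_one, Localization.mk_eq_mk_iff,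
    Localization.r_iff_exists]
  refine ⟨1, ?_⟩
  simp
  ring

lemma coordQuot_mul (i j : Fin 2) :
    (res (inf_le_left : D i ⊓ D j ≤ D i) (coordQuot i j)) *
      (res (inf_le_right : D i ⊓ D j ≤ D j) (coordQuot j i)) = 1 := by
  have hi : D i ⊓ D j = Proj.basicOpen homogPoly (MvPolynomial.X i * MvPolynomial.X j) :=
    (Proj.basicOpen_mul _ _ _).symm
  have e₁ := congrArg (fun f ↦ f.hom (coordFrac i j))
    (Proj.awayMap_awayToSection homogPoly (f := MvPolynomial.X i) (X_mem j) rfl)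
  have e₂ := congrArg (fun f ↦ f.hom (coordFrac j i))
    (Proj.awayMap_awayToSection homogPoly (f := MvPolynomial.X j) (X_mem i) (mul_comm _ _))
  have key := congrArg (res hi.le) (congrArg₂ (· * ·) e₁ e₂)
  simp only [CommRingCat.hom_comp, RingHom.comp_apply, map_mul] at key
  refine Eq.trans ?_ (key.symm.trans ?_)
  · exact congrArg₂ (· * ·) (res_res hi.le (hi.ge.trans inf_le_left) _).symm
      (res_res hi.le (hi.ge.trans inf_le_right) _).symm
  · rw [← map_mul, ← map_mul]
    exact (congrArg _ (congrArg _ (coordFrac_mul i j))).trans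
      ((congrArg _ (map_one _)).trans (map_one _))

/-- The invertible function `x / y` on `{x ≠ 0, y ≠ 0}`. -/
def ratio : Γ(P1, D 0 ⊓ D 1)ˣ where
  val := res inf_le_right (coordQuot 1 0)
  inv := res inf_le_left (coordQuot 0 1)
  val_inv := by rw [mul_comm]; exact coordQuot_mul 0 1
  inv_val := coordQuot_mul 0 1

/-- The line bundle `𝒪(n)`. A section is a pair `(s₀, s₁)` with `s₁ = (x / y) ^ n s₀`; it stands
for the homogeneous expression `x ^ n s₀ = y ^ n s₁` of degree `n`. -/
def O (n : ℤ) : P1.Modules := glue (D 0) (D 1) (ratio ^ n)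

/-- Multiplication by `x ^ i y ^ j`, from `𝒪(m)` to `𝒪(m + i + j)`. In the charts it is
`s₀ ↦ (y / x) ^ j s₀` and `s₁ ↦ (x / y) ^ i s₁`. -/
def mulMonomial (i j : ℕ) {m n : ℤ} (h : n = m + i + j) : O m ⟶ O n :=
  glueHom (coordQuot 0 1 ^ j) (coordQuot 1 0 ^ i) (by
    subst h
    have hu : res inf_le_right (coordQuot 1 0) = (ratio : Γ(P1, D 0 ⊓ D 1)) := rfl
    have ht : res inf_le_left (coordQuot 0 1) = ((ratio⁻¹ : Γ(P1, D 0 ⊓ D 1)ˣ) :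
      Γ(P1, D 0 ⊓ D 1)) := rfl
    rw [map_pow, map_pow, hu, ht, ← Units.val_pow_eq_pow_val, ← Units.val_pow_eq_pow_val,
      ← Units.val_mul, ← Units.val_mul]
    congr 1
    rw [inv_pow, zpow_add, zpow_natCast, mul_inv_cancel_right, zpow_add, zpow_natCast, mul_comm])

/-- The structure homomorphism from `ℂ` to the global functions on the projective line. -/
def scalars : ℂ →+* Γ(P1, ⊤) :=
  ((Scheme.ΓSpecIso (.of (homogPoly 0))).inv ≫ (Proj.toSpecZero homogPoly).appTop).hom.comp
    (algebraMap ℂ (homogPoly 0))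

instance : Linear ℂ P1.Modules := linearOfGlobal scalars

instance : HasExt.{1} P1.Modules := HasExt.standard _

instance : HasFiniteBiproducts P1.Modules := Abelian.hasFiniteBiproducts

lemma mulMonomial_comp (i j k l : ℕ) {m n p : ℤ} (h : n = m + i + j) (h' : p = n + k + l)
    (h'' : p = m + (i + k : ℕ) + (j + l : ℕ)) :
    mulMonomial i j h ≫ mulMonomial k l h' = mulMonomial (i + k) (j + l) h'' := by
  ext U s
  refine glueSections_ext (U₀ := D 0) (U₁ := D 1) (g := ratio ^ p) (U := U) ?_ ?_
  · change res inf_le_right _ * (res inf_le_right _ * _) = res inf_le_right _ * _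
    rw [← mul_assoc, ← map_mul, ← pow_add, add_comm l j]
  · change res inf_le_right _ * (res inf_le_right _ * _) = res inf_le_right _ * _
    rw [← mul_assoc, ← map_mul, ← pow_add, add_comm k i]

/-- The map `𝒪(-2)^3 ⟶ 𝒪(-2) ⊕ 𝒪(-1)^4` with matrix rows
`(a, b, c), (x, 0, 0), (y, x, 0), (0, y, x), (0, 0, y)`. -/
def presentation (a b c : ℂ) :
    (⨁ fun _ : Fin 3 ↦ O (-2)) ⟶ O (-2) ⊞ (⨁ fun _ : Fin 4 ↦ O (-1)) :=
  biprod.lift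
    (biproduct.desc ![a • 𝟙 (O (-2)), b • 𝟙 (O (-2)), c • 𝟙 (O (-2))])
    (biproduct.matrix fun j i ↦
      (!![mulMonomial 1 0 (by norm_num), 0, 0;
          mulMonomial 0 1 (by norm_num), mulMonomial 1 0 (by norm_num), 0;
          0, mulMonomial 0 1 (by norm_num), mulMonomial 1 0 (by norm_num);
          0, 0, mulMonomial 0 1 (by norm_num)] : Matrix (Fin 4) (Fin 3) (O (-2) ⟶ O (-1))) i j)

/-- The cokernel of `presentation a b c`. -/
abbrev middle (a b c : ℂ) : P1.Modules := cokernel (presentation a b c)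

/-- The map from `𝒪(-2)` to the cokernel, through the first summand. -/
def middleInl (a b c : ℂ) : O (-2) ⟶ middle a b c :=
  biprod.inl ≫ cokernel.π (presentation a b c)

/-- The map `(y^3, -x y^2, x^2 y, -x^3) : 𝒪(-1)^4 ⟶ 𝒪(2)`. -/
def quotForm : (⨁ fun _ : Fin 4 ↦ O (-1)) ⟶ O 2 :=
  biproduct.desc ![mulMonomial 0 3 (by norm_num), -mulMonomial 1 2 (by norm_num),
    mulMonomial 2 1 (by norm_num), -mulMonomial 3 0 (by norm_num)]

lemma presentation_comp (a b c : ℂ) :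
    presentation a b c ≫ biprod.desc 0 quotForm = 0 := by
  rw [presentation, biprod.lift_desc, comp_zero, zero_add, quotForm]
  refine biproduct.hom_ext' _ _ fun i ↦ ?_
  rw [biproduct.matrix_desc, biproduct.ι_desc, comp_zero]
  simp only [Fin.sum_univ_four]
  fin_cases i <;> simp <;>
    rw [mulMonomial_comp _ _ _ _ _ _ (by norm_num), mulMonomial_comp _ _ _ _ _ _ (by norm_num)] <;>
    simp

/-- The map from the cokernel to `𝒪(2)` that is zero on `𝒪(-2)` and `quotForm` on `𝒪(-1)^4`. -/
def middleProj (a b c : ℂ) : middle a b c ⟶ O 2 :=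
  cokernel.desc _ (biprod.desc 0 quotForm) (presentation_comp a b c)

/-- The sequence `𝒪(-2) ⟶ middle a b c ⟶ 𝒪(2)`. -/
def extensionSeq (a b c : ℂ) : ShortComplex P1.Modules :=
  ShortComplex.mk (middleInl a b c) (middleProj a b c) (by simp [middleInl, middleProj])
end
end P1Ext

open P1Ext

/-!
The cubic monomials, up to sign, generate `𝒪(2)` over `𝒪(-1)^4`, and the relations between them are
generated by the three columns of linear forms in the matrix: this is the short exact sequence
`cubicSeq : 𝒪(-2)^3 ⟶ 𝒪(-1)^4 ⟶ 𝒪(2)`, checked on sections in coordinates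
(`cubicSeq_shortExact`). The cokernel of the matrix with parameters `(a, b, c)` is the pushout of
this sequence along the row `(a, b, c) : 𝒪(-2)^3 ⟶ 𝒪(-2)`, hence an extension with class the image
of minus that row under the connecting map `Hom(𝒪(-2)^3, 𝒪(-2)) ⟶ Ext¹(𝒪(2), 𝒪(-2))`
(`pushoutSeq_shortExact`, `pushoutSeq_extClass`). The connecting map is bijective because
`Hom(𝒪(-1), 𝒪(-2))` and `Ext¹(𝒪(-1), 𝒪(-2))` vanish, and its source is `ℂ³` because the
endomorphisms of `𝒪(-2)` are scalars.

The vanishing of `Ext¹(𝒪(-1), 𝒪(-2))` avoids injective resolutions. Every class in `Ext¹(X, Y)` is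
killed by some monomorphism out of `Y` (`exists_mono_comp_eq_zero`), so it suffices to lift
morphisms from `𝒪(-1)` along an epimorphism with kernel `𝒪(-2)`. Lifts exist over each of the two
charts, by partial fractions in `ℂ[t]` and compactness (`exists_lift_of_isAffineOpen`), and the
difference of the two lifts on the overlap is removed because every Laurent polynomial is a sum of a
polynomial in `y / x` and a multiple of `x / y` by a polynomial in `x / y`
(`exists_eq_mul_res_add_res`).

Let `ξ` be the class of `(a, b, c)`. If it is zero, the extension splits. Otherwise, an epimorphism
`q : F ⟶ 𝒪(2)` with kernel `𝒪(-2)` and `q^* ξ = 0` lifts to the middle term, and the lift is an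
isomorphism, since on `𝒪(-2)` it is a scalar that cannot vanish
(`nonempty_iso_of_comp_extClass_eq_zero`). Such maps come from Koszul complexes of pairs of forms
without common zeros (`koszul_shortExact`). The pullback of `ξ` along the quadratic form
`α x ^ 2 + β x y + γ y ^ 2` vanishes as soon as `α c - β b + γ a = 0`
(`quadraticForm_comp_classMap`), and the pullback along a linear form `l` vanishes as soon as those
along `x l` and `y l` do (`linearForm_comp_classMap`). If `b ^ 2 = a c`, there is such an `l`, and
`l` with a cubic form gives `𝒪(-1) ⊕ 𝒪(1)`. If `b ^ 2 ≠ a c`, the quadratic forms orthogonal to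
the class form a pencil without base points, which gives `𝒪 ⊕ 𝒪`.
-/

namespace P1Ext
noncomputable section

/-! ### Sections of sheaves of modules -/

section

variable {X : Scheme.{0}} {L M N : X.Modules} {U V W : X.Opens}

/-- Restriction of sections of a sheaf of modules to a smaller open set. -/
def secRes (M : X.Modules) (h : V ≤ W) : Γ(M, W) →+ Γ(M, V) :=
  (M.presheaf.map (homOfLE h).op).hom

lemma secRes_secRes (h : U ≤ V) (h' : V ≤ W) (s : Γ(M, W)) :
    secRes M h (secRes M h' s) = secRes M (h.trans h') s := by
  simp only [secRes, ← AddCommGrpCat.comp_apply, ← Functor.map_comp, ← op_comp]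
  rfl

lemma secRes_self (h : U ≤ U) (s : Γ(M, U)) : secRes M h s = s := by
  simp [secRes]

lemma secRes_smul (h : V ≤ W) (r : Γ(X, W)) (s : Γ(M, W)) :
    secRes M h (r • s) = res h r • secRes M h s :=
  M.map_smul (homOfLE h) r s

lemma app_secRes (f : M ⟶ N) (h : V ≤ W) (s : Γ(M, W)) :
    f.app V (secRes M h s) = secRes N h (f.app W s) :=
  NatTrans.naturality_apply f.mapPresheaf (homOfLE h).op s

lemma comp_app_apply (f : L ⟶ M) (g : M ⟶ N) (s : Γ(L, U)) :
    (f ≫ g).app U s = g.app U (f.app U s) := rfl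

lemma add_app_apply (f g : M ⟶ N) (s : Γ(M, U)) :
    (f + g).app U s = f.app U s + g.app U s := rfl

lemma neg_app_apply (f : M ⟶ N) (s : Γ(M, U)) : (-f).app U s = -f.app U s := by
  rw [eq_neg_iff_add_eq_zero, ← add_app_apply, neg_add_cancel]; rfl

lemma zero_app_apply (s : Γ(M, U)) : (0 : M ⟶ N).app U s = 0 := rfl

lemma id_app_apply (s : Γ(M, U)) : (𝟙 M : M ⟶ M).app U s = s := rfl

lemma sum_app_apply {ι : Type} (t : Finset ι) (f : ι → (M ⟶ N)) (s : Γ(M, U)) :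
    (∑ i ∈ t, f i).app U s = ∑ i ∈ t, (f i).app U s := by
  classical
  induction t using Finset.induction_on with
  | empty => simp
  | insert a t ha ih => rw [Finset.sum_insert ha, Finset.sum_insert ha, add_app_apply, ih]

lemma hom_ext_apply {f g : M ⟶ N} (h : ∀ (U : X.Opens) (s : Γ(M, U)), f.app U s = g.app U s) :
    f = g := by
  ext U s
  exact h U s

variable (M) in
/-- The sheaf of abelian groups underlying a sheaf of modules. -/
def abSheaf : TopCat.Sheaf Ab X := ⟨M.presheaf, M.isSheaf⟩

/-- A section over a union of open sets is determined by its restrictions. -/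
lemma sec_ext {ι : Type} (U : ι → X.Opens) (V : X.Opens) (hU : ∀ i, U i ≤ V) (hV : V ≤ iSup U)
    {s t : Γ(M, V)} (h : ∀ i, secRes M (hU i) s = secRes M (hU i) t) : s = t :=
  (abSheaf M).eq_of_locally_eq' U V (fun i ↦ homOfLE (hU i)) hV s t h

lemma sec_ext₂ {A B V : X.Opens} (hA : A ≤ V) (hB : B ≤ V) (hV : V ≤ A ⊔ B) {s t : Γ(M, V)}
    (h₁ : secRes M hA s = secRes M hA t) (h₂ : secRes M hB s = secRes M hB t) : s = t :=
  (abSheaf M).eq_of_locally_eq₂ (homOfLE hA) (homOfLE hB) hV s t h₁ h₂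

/-- Sections over two open sets that agree on the intersection come from the union. -/
lemma exists_glue₂ {A B V : X.Opens} (hA : A ≤ V) (hB : B ≤ V) (hV : V ≤ A ⊔ B)
    (s : Γ(M, A)) (t : Γ(M, B))
    (h : secRes M (inf_le_left : A ⊓ B ≤ A) s = secRes M (inf_le_right : A ⊓ B ≤ B) t) :
    ∃ r : Γ(M, V), secRes M hA r = s ∧ secRes M hB r = t := by
  let U : Bool → X.Opens := fun b ↦ cond b A B
  let sf : ∀ b, Γ(M, U b) := fun b ↦ match b with
    | true => s
    | false => t
  have hU : ∀ b, U b ≤ V := by rintro (_ | _) <;> assumption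
  obtain ⟨r, hr, -⟩ := (abSheaf M).existsUnique_gluing' U V (fun b ↦ homOfLE (hU b))
    (by rwa [iSup_bool_eq]) sf (by
      have h' : secRes M (inf_le_left : B ⊓ A ≤ B) t = secRes M (inf_le_right : B ⊓ A ≤ A) s := by
        have := congrArg (secRes M (le_inf inf_le_right inf_le_left : B ⊓ A ≤ A ⊓ B)) h
        rw [secRes_secRes, secRes_secRes] at this
        exact this.symm
      rintro (_ | _) (_ | _)
      exacts [rfl, h', h, rfl])
  exact ⟨r, hr true, hr false⟩

section Exactness

variable (X) in
/-- Sections over `U`, as a functor. -/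
def secFunctor (U : X.Opens) : X.Modules ⥤ Ab :=
  Scheme.Modules.toPresheaf X ⋙ (evaluation X.Opensᵒᵖ Ab.{0}).obj (op U)

instance (U : X.Opens) : PreservesFiniteLimits (secFunctor X U) :=
  have : PreservesFiniteLimits ((evaluation X.Opensᵒᵖ Ab.{0}).obj (op U)) := inferInstance
  comp_preservesFiniteLimits (Scheme.Modules.toPresheaf X) _

instance (U : X.Opens) : (secFunctor X U).Additive where

lemma app_injective (f : M ⟶ N) [Mono f] (U : X.Opens) : Function.Injective (f.app U) :=
  (AddCommGrpCat.mono_iff_injective ((secFunctor X U).map f)).1 inferInstance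

lemma exists_app_eq_of_exact {S : ShortComplex X.Modules} (hS : S.ShortExact) (U : X.Opens)
    (s : Γ(S.X₂, U)) (hs : S.g.app U s = 0) : ∃ t : Γ(S.X₁, U), S.f.app U t = s := by
  have h : PreservesFiniteLimits (secFunctor X U) ↔ ∀ (S : ShortComplex X.Modules),
      S.ShortExact → (S.map (secFunctor X U)).Exact ∧ Mono ((secFunctor X U).map S.f) :=
    (Functor.preservesFiniteLimits_tfae (secFunctor X U)).out 3 0
  exact (ShortComplex.ab_exact_iff _).1 (h.1 inferInstance S hS).1 s hs

/-- Epimorphisms of sheaves of modules are locally surjective: the presheaf cokernel has zero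
sheafification, so each of its sections vanishes locally. -/
lemma exists_local_lift_of_epi (f : M ⟶ N) [Epi f] (s : Γ(N, U)) (x : X) (hx : x ∈ U) :
    ∃ (V : X.Opens) (h : V ≤ U), x ∈ V ∧ ∃ t : Γ(M, V), f.app V t = secRes N h s := by
  let R := X.ringCatSheaf
  let a := PresheafOfModules.sheafification.{0} (𝟙 R.obj)
  let G := SheafOfModules.forget.{0} R ⋙ PresheafOfModules.restrictScalars (𝟙 R.obj)
  let adj : a ⊣ G := PresheafOfModules.sheafificationAdjunction (𝟙 R.obj)
  let M' : SheafOfModules R := M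
  let N' : SheafOfModules R := N
  let f' : M' ⟶ N' := f
  have : Epi f' := ‹Epi f›
  let φ := G.map f'
  let π := cokernel.π φ
  have h₁ : Epi (a.map φ ≫ adj.counit.app N') := by
    have : a.map φ ≫ adj.counit.app N' = adj.counit.app M' ≫ f' := adj.counit.naturality f'
    rw [this]
    exact epi_comp _ _
  have h₂ : Epi (a.map φ) := (MorphismProperty.epimorphisms _).of_postcomp (W' := .isomorphisms _)
    (a.map φ) (adj.counit.app N') (inferInstanceAs (IsIso (adj.counit.app N'))) h₁
  have h₃ : a.map π = 0 := by
    rw [← cancel_epi (a.map φ), ← a.map_comp, cokernel.condition, a.map_zero, comp_zero]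
  have h₄ : IsZero (a.obj (cokernel φ)) := by
    have : Epi (a.map π) := inferInstance
    exact IsZero.of_epi_eq_zero _ h₃
  have h₅ : toSheafify (Opens.grothendieckTopology X) (cokernel φ).presheaf = 0 := by
    change (PresheafOfModules.toPresheaf _).map (adj.unit.app (cokernel φ)) = 0
    have : adj.unit.app (cokernel φ) = 0 := (G.map_isZero h₄).eq_of_tgt _ _
    rw [this, Functor.map_zero]
  let s' : (G.obj N').obj (op U) := s
  let y : ((cokernel φ).presheaf.obj (op U) : Type) := π.app (op U) s'
  have hy := Presheaf.equalizerSieve_mem (Opens.grothendieckTopology X)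
    (toSheafify (Opens.grothendieckTopology X) (cokernel φ).presheaf) y 0 (by rw [h₅]; rfl)
  obtain ⟨V, i, hi, hxV⟩ := hy x hx
  refine ⟨V, i.le, hxV, ?_⟩
  have hi' : (cokernel φ).presheaf.map i.op y = (cokernel φ).presheaf.map i.op 0 := hi
  rw [map_zero] at hi'
  have h₆ : π.app (op V) ((G.obj N').map i.op s') = 0 :=
    (PresheafOfModules.naturality_apply π i.op s').trans hi'
  have h₇ := (ShortComplex.exact_cokernel φ).map (PresheafOfModules.evaluation R.obj (op V))
  exact (ShortComplex.moduleCat_exact_iff _).1 h₇ _ h₆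

/-- A short complex of sheaves of modules is short exact if it is so on sections over all open
sets contained in one of two open sets that cover the scheme. -/
lemma shortExact_of_sections {S : ShortComplex X.Modules} {A B : X.Opens} (hAB : A ⊔ B = ⊤)
    (hinj : ∀ V : X.Opens, V ≤ A ∨ V ≤ B → ∀ s : Γ(S.X₁, V), S.f.app V s = 0 → s = 0)
    (hex : ∀ V : X.Opens, V ≤ A ∨ V ≤ B → ∀ s : Γ(S.X₂, V), S.g.app V s = 0 →
      ∃ t, S.f.app V t = s)
    (hsurj : ∀ V : X.Opens, V ≤ A ∨ V ≤ B → ∀ s : Γ(S.X₃, V), ∃ t, S.g.app V t = s) :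
    S.ShortExact := by
  have hcov (U : X.Opens) : U ≤ (U ⊓ A) ⊔ (U ⊓ B) := by rw [← inf_sup_left, hAB, inf_top_eq]
  have hepi {M N : X.Modules} (f : M ⟶ N)
      (h : ∀ V : X.Opens, V ≤ A ∨ V ≤ B → ∀ s : Γ(N, V), ∃ t, f.app V t = s) : Epi f := by
    refine ⟨fun {K} g g' hg ↦ hom_ext_apply fun U s ↦ ?_⟩
    have key (V : X.Opens) (hV : V ≤ A ∨ V ≤ B) (hVU : V ≤ U) :
        secRes K hVU (g.app U s) = secRes K hVU (g'.app U s) := by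
      obtain ⟨t, ht⟩ := h V hV (secRes N hVU s)
      rw [← app_secRes, ← app_secRes, ← ht, ← comp_app_apply, ← comp_app_apply, hg]
    exact sec_ext₂ inf_le_left inf_le_left (hcov U) (key _ (.inl inf_le_right) _)
      (key _ (.inr inf_le_right) _)
  have hmono : Mono S.f := by
    refine ⟨fun {K} g g' hg ↦ hom_ext_apply fun U s ↦ ?_⟩
    rw [← sub_eq_zero]
    have hz : S.f.app U (g.app U s - g'.app U s) = 0 := by
      rw [map_sub, ← comp_app_apply, ← comp_app_apply, hg, sub_self]
    have key (V : X.Opens) (hV : V ≤ A ∨ V ≤ B) (hVU : V ≤ U) :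
        secRes S.X₁ hVU (g.app U s - g'.app U s) = secRes S.X₁ hVU 0 := by
      rw [map_zero]
      exact hinj V hV _ (by rw [app_secRes, hz, map_zero])
    exact sec_ext₂ inf_le_left inf_le_left (hcov U) (key _ (.inl inf_le_right) _)
      (key _ (.inr inf_le_right) _)
  have hexact : S.Exact := by
    rw [S.exact_iff_epi_kernel_lift]
    refine hepi _ fun V hV s ↦ ?_
    obtain ⟨t, ht⟩ := hex V hV ((kernel.ι S.g).app V s) (by
      rw [← comp_app_apply, kernel.condition]; rfl)
    refine ⟨t, app_injective (kernel.ι S.g) V ?_⟩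
    rw [← comp_app_apply, kernel.lift_ι, ht]
  exact { exact := hexact, mono_f := hmono, epi_g := hepi _ hsurj }

end Exactness

end

/-! ### Morphisms out of a glued sheaf -/

section

variable {X : Scheme.{0}} {M N : X.Modules} {U V W : X.Opens}
variable {U₀ U₁ : X.Opens} {g : Γ(X, U₀ ⊓ U₁)ˣ}

/-- A section of a glued sheaf, as a pair of functions. -/
def toPair (s : Γ(glue U₀ U₁ g, U)) : glueSections U₀ U₁ g U := s

/-- A compatible pair of functions, as a section of the glued sheaf. -/
def ofPair (s : glueSections U₀ U₁ g U) : Γ(glue U₀ U₁ g, U) := s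

lemma toPair_ext {s t : Γ(glue U₀ U₁ g, U)} (h₀ : (toPair s).1.1 = (toPair t).1.1)
    (h₁ : (toPair s).1.2 = (toPair t).1.2) : s = t :=
  glueSections_ext h₀ h₁

lemma toPair_smul (r : Γ(X, U)) (s : Γ(glue U₀ U₁ g, U)) : toPair (r • s) = r • toPair s := rfl

lemma toPair_secRes (h : V ≤ U) (s : Γ(glue U₀ U₁ g, U)) :
    toPair (secRes _ h s) = glueRes h (toPair s) := rfl

variable (U₀ U₁ g) in
/-- The generator `(1, g)` over `U₀` of the glued sheaf. -/
def gen₀ : Γ(glue U₀ U₁ g, U₀) :=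
  ofPair ⟨(1, res (le_inf inf_le_left inf_le_right) (g : Γ(X, U₀ ⊓ U₁))), by
    rw [mem_glueSections]; simp only [map_one, mul_one, res_res]⟩

variable (U₀ U₁ g) in
/-- The generator `(g⁻¹, 1)` over `U₁` of the glued sheaf. -/
def gen₁ : Γ(glue U₀ U₁ g, U₁) :=
  ofPair ⟨(res (le_inf inf_le_right inf_le_left) ((g⁻¹ : Γ(X, U₀ ⊓ U₁)ˣ) : Γ(X, U₀ ⊓ U₁)), 1), by
    rw [mem_glueSections]; simp only [map_one, res_res, ← map_mul, Units.mul_inv]⟩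

lemma secRes_eq_smul_gen₀ (h : V ≤ U) (h₀ : V ≤ U₀) (s : Γ(glue U₀ U₁ g, U)) :
    secRes _ h s = res (le_inf h h₀) (toPair s).1.1 • secRes _ h₀ (gen₀ U₀ U₁ g) := by
  refine toPair_ext ?_ ?_
  · rw [toPair_smul, smul_fst, toPair_secRes, toPair_secRes]
    change res _ _ = res _ (res _ _) * res _ 1
    rw [map_one, mul_one, res_res]
  · rw [toPair_smul, smul_snd, toPair_secRes, toPair_secRes]
    change res _ _ = res _ (res _ _) * res _ (res _ _)
    have := congrArg (res (le_inf (inf_le_left.trans h) (le_inf (inf_le_left.trans h₀)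
      inf_le_right) : V ⊓ U₁ ≤ U ⊓ (U₀ ⊓ U₁))) (mem_glueSections.1 (toPair s).2)
    simp only [map_mul, res_res] at this ⊢
    rw [this, mul_comm]

lemma secRes_eq_smul_gen₁ (h : V ≤ U) (h₁ : V ≤ U₁) (s : Γ(glue U₀ U₁ g, U)) :
    secRes _ h s = res (le_inf h h₁) (toPair s).1.2 • secRes _ h₁ (gen₁ U₀ U₁ g) := by
  refine toPair_ext ?_ ?_
  · rw [toPair_smul, smul_fst, toPair_secRes, toPair_secRes]
    change res _ _ = res _ (res _ _) * res _ (res _ _)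
    have := congrArg (res (le_inf (inf_le_left.trans h) (le_inf inf_le_right
      (inf_le_left.trans h₁)) : V ⊓ U₀ ≤ U ⊓ (U₀ ⊓ U₁))) (mem_glueSections.1 (toPair s).2)
    simp only [map_mul, res_res] at this ⊢
    rw [this, mul_right_comm, ← map_mul, Units.mul_inv, map_one, one_mul]
  · rw [toPair_smul, smul_snd, toPair_secRes, toPair_secRes]
    change res _ _ = res _ (res _ _) * res _ 1
    rw [map_one, mul_one, res_res]

lemma secRes_gen₀ (h₀ : V ≤ U₀) (h₁ : V ≤ U₁) :
    secRes _ h₀ (gen₀ U₀ U₁ g) =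
      res (le_inf h₀ h₁) (g : Γ(X, U₀ ⊓ U₁)) • secRes _ h₁ (gen₁ U₀ U₁ g) := by
  rw [secRes_eq_smul_gen₁ h₀ h₁]
  congr 1
  exact res_res _ _ _

/-- A morphism out of a glued sheaf is determined by the images of the two generators. -/
lemma glue_hom_ext (hU : U₀ ⊔ U₁ = ⊤) {f f' : glue U₀ U₁ g ⟶ M}
    (h₀ : f.app U₀ (gen₀ U₀ U₁ g) = f'.app U₀ (gen₀ U₀ U₁ g))
    (h₁ : f.app U₁ (gen₁ U₀ U₁ g) = f'.app U₁ (gen₁ U₀ U₁ g)) : f = f' := by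
  refine hom_ext_apply fun U s ↦ sec_ext₂ (A := U ⊓ U₀) (B := U ⊓ U₁) inf_le_left inf_le_left
    (by rw [← inf_sup_left, hU, inf_top_eq]) ?_ ?_
  · rw [← app_secRes, ← app_secRes, secRes_eq_smul_gen₀ _ inf_le_right]
    rw [Scheme.Modules.Hom.app_smul, Scheme.Modules.Hom.app_smul, app_secRes, app_secRes, h₀]
  · rw [← app_secRes, ← app_secRes, secRes_eq_smul_gen₁ _ inf_le_right]
    rw [Scheme.Modules.Hom.app_smul, Scheme.Modules.Hom.app_smul, app_secRes, app_secRes, h₁]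

section Desc

variable (hU : U₀ ⊔ U₁ = ⊤) (t₀ : Γ(M, U₀)) (t₁ : Γ(M, U₁))
  (ht : secRes M (inf_le_left : U₀ ⊓ U₁ ≤ U₀) t₀ =
    (g : Γ(X, U₀ ⊓ U₁)) • secRes M (inf_le_right : U₀ ⊓ U₁ ≤ U₁) t₁)

include hU ht in
lemma exists_glueDesc (U : X.Opens) (s : glueSections U₀ U₁ g U) :
    ∃ r : Γ(M, U), secRes M (inf_le_left : U ⊓ U₀ ≤ U) r = s.1.1 • secRes M inf_le_right t₀ ∧
      secRes M (inf_le_left : U ⊓ U₁ ≤ U) r = s.1.2 • secRes M inf_le_right t₁ := by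
  refine exists_glue₂ (A := U ⊓ U₀) (B := U ⊓ U₁) inf_le_left inf_le_left
    (by rw [← inf_sup_left, hU, inf_top_eq]) _ _ ?_
  have hle : (U ⊓ U₀) ⊓ (U ⊓ U₁) ≤ U ⊓ (U₀ ⊓ U₁) :=
    le_inf (inf_le_left.trans inf_le_left) (inf_le_inf inf_le_right inf_le_right)
  have e₁ := congrArg (res hle) (mem_glueSections.1 s.2)
  have e₂ := congrArg (secRes M (hle.trans inf_le_right)) ht
  simp only [map_mul, res_res] at e₁
  rw [secRes_smul, secRes_secRes, secRes_secRes] at e₂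
  rw [secRes_smul, secRes_smul, secRes_secRes, secRes_secRes, e₁, e₂, smul_smul, mul_comm]

/-- The morphism out of a glued sheaf with prescribed images of the two generators, on sections. -/
def glueDescFun (U : X.Opens) (s : glueSections U₀ U₁ g U) : Γ(M, U) :=
  (exists_glueDesc hU t₀ t₁ ht U s).choose

lemma secRes_glueDescFun₀ {U : X.Opens} (s : glueSections U₀ U₁ g U) (hV : V ≤ U) (h₀ : V ≤ U₀) :
    secRes M hV (glueDescFun hU t₀ t₁ ht U s) = res (le_inf hV h₀) s.1.1 • secRes M h₀ t₀ := by
  have := congrArg (secRes M (le_inf hV h₀)) (exists_glueDesc hU t₀ t₁ ht U s).choose_spec.1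
  rwa [secRes_secRes, secRes_smul, secRes_secRes] at this

lemma secRes_glueDescFun₁ {U : X.Opens} (s : glueSections U₀ U₁ g U) (hV : V ≤ U) (h₁ : V ≤ U₁) :
    secRes M hV (glueDescFun hU t₀ t₁ ht U s) = res (le_inf hV h₁) s.1.2 • secRes M h₁ t₁ := by
  have := congrArg (secRes M (le_inf hV h₁)) (exists_glueDesc hU t₀ t₁ ht U s).choose_spec.2
  rwa [secRes_secRes, secRes_smul, secRes_secRes] at this

include hU in
lemma sec_ext_cover {s t : Γ(M, U)}
    (h₀ : secRes M (inf_le_left : U ⊓ U₀ ≤ U) s = secRes M inf_le_left t)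
    (h₁ : secRes M (inf_le_left : U ⊓ U₁ ≤ U) s = secRes M inf_le_left t) : s = t :=
  sec_ext₂ inf_le_left inf_le_left (by rw [← inf_sup_left, hU, inf_top_eq]) h₀ h₁

/-- `glueDescFun` as an additive map. -/
def glueDescAdd (U : X.Opens) : glueSections U₀ U₁ g U →+ Γ(M, U) :=
  AddMonoidHom.mk' (glueDescFun hU t₀ t₁ ht U) fun s s' ↦ by
    refine sec_ext_cover hU ?_ ?_
    · rw [map_add, secRes_glueDescFun₀ hU t₀ t₁ ht _ _ inf_le_right,
        secRes_glueDescFun₀ hU t₀ t₁ ht _ _ inf_le_right,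
        secRes_glueDescFun₀ hU t₀ t₁ ht _ _ inf_le_right, ← add_smul, ← map_add]
      rfl
    · rw [map_add, secRes_glueDescFun₁ hU t₀ t₁ ht _ _ inf_le_right,
        secRes_glueDescFun₁ hU t₀ t₁ ht _ _ inf_le_right,
        secRes_glueDescFun₁ hU t₀ t₁ ht _ _ inf_le_right, ← add_smul, ← map_add]
      rfl

lemma glueDescFun_glueRes {U : X.Opens} (h : V ≤ U) (s : glueSections U₀ U₁ g U) :
    glueDescFun hU t₀ t₁ ht V (glueRes h s) = secRes M h (glueDescFun hU t₀ t₁ ht U s) := by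
  refine sec_ext_cover hU ?_ ?_
  · rw [secRes_secRes, secRes_glueDescFun₀ hU t₀ t₁ ht _ _ inf_le_right,
      secRes_glueDescFun₀ hU t₀ t₁ ht _ _ inf_le_right]
    congr 1
    exact res_res _ _ _
  · rw [secRes_secRes, secRes_glueDescFun₁ hU t₀ t₁ ht _ _ inf_le_right,
      secRes_glueDescFun₁ hU t₀ t₁ ht _ _ inf_le_right]
    congr 1
    exact res_res _ _ _

lemma glueDescFun_smul {U : X.Opens} (r : Γ(X, U)) (s : glueSections U₀ U₁ g U) :
    glueDescFun hU t₀ t₁ ht U (r • s) = r • glueDescFun hU t₀ t₁ ht U s := by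
  refine sec_ext_cover hU ?_ ?_
  · rw [secRes_smul, secRes_glueDescFun₀ hU t₀ t₁ ht _ _ inf_le_right,
      secRes_glueDescFun₀ hU t₀ t₁ ht _ _ inf_le_right, smul_fst, map_mul, res_res, mul_smul]
  · rw [secRes_smul, secRes_glueDescFun₁ hU t₀ t₁ ht _ _ inf_le_right,
      secRes_glueDescFun₁ hU t₀ t₁ ht _ _ inf_le_right, smul_snd, map_mul, res_res, mul_smul]

/-- The morphism out of a glued sheaf sending the two generators to given compatible sections. -/
def glueDesc : glue U₀ U₁ g ⟶ M where
  val := PresheafOfModules.homMk (M₁ := (glue U₀ U₁ g).val) (M₂ := M.val)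
    { app U := AddCommGrpCat.ofHom (X := glueSections U₀ U₁ g U.unop) (Y := Γ(M, U.unop))
        (glueDescAdd hU t₀ t₁ ht U.unop)
      naturality _ _ i := AddCommGrpCat.hom_ext (AddMonoidHom.ext fun s ↦
        glueDescFun_glueRes hU t₀ t₁ ht i.unop.le s) }
    fun U r s ↦ glueDescFun_smul hU t₀ t₁ ht (U := U.unop) r s

lemma glueDesc_gen₀ : (glueDesc hU t₀ t₁ ht).app U₀ (gen₀ U₀ U₁ g) = t₀ := by
  have := secRes_glueDescFun₀ hU t₀ t₁ ht (toPair (gen₀ U₀ U₁ g)) le_rfl le_rfl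
  rw [secRes_self, secRes_self] at this
  refine Eq.trans this ?_
  change res _ 1 • t₀ = t₀
  rw [map_one, one_smul]

lemma glueDesc_gen₁ : (glueDesc hU t₀ t₁ ht).app U₁ (gen₁ U₀ U₁ g) = t₁ := by
  have := secRes_glueDescFun₁ hU t₀ t₁ ht (toPair (gen₁ U₀ U₁ g)) le_rfl le_rfl
  rw [secRes_self, secRes_self] at this
  refine Eq.trans this ?_
  change res _ 1 • t₁ = t₁
  rw [map_one, one_smul]

end Desc

end

/-! ### Surjectivity on sections over affine open sets -/

section

variable {X : Scheme.{0}} {M N : X.Modules} {U V W : X.Opens}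

/-- In an affine open set whose ring is principal, every open set is basic. -/
lemma exists_eq_basicOpen (hW : IsAffineOpen W) [IsPrincipalIdealRing Γ(X, W)] (hV : V ≤ W) :
    ∃ f : Γ(X, W), V = X.basicOpen f := by
  obtain ⟨s, hs⟩ := (PrimeSpectrum.isClosed_iff_zeroLocus_ideal _).1
    (hW.fromSpec ⁻¹ᵁ V).isOpen.isClosed_compl
  obtain ⟨f, rfl⟩ := (IsPrincipalIdealRing.principal s).principal
  refine ⟨f, ?_⟩
  have h : hW.fromSpec ⁻¹ᵁ V = PrimeSpectrum.basicOpen f := by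
    refine Opens.ext (compl_injective (hs.trans (Eq.trans ?_
      (congrArg compl (PrimeSpectrum.basicOpen_eq_zeroLocus_compl f)).symm)))
    refine Eq.trans ?_ (compl_compl _).symm
    rw [Ideal.submodule_span_eq, PrimeSpectrum.zeroLocus_span]
  rw [← hW.fromSpec_image_basicOpen, ← h]
  ext1
  change _ = hW.fromSpec '' (hW.fromSpec ⁻¹' (V : Set X))
  rw [Set.image_preimage_eq_inter_range, hW.range_fromSpec, Set.inter_eq_left.2 hV]

lemma exists_coprime_factorization {A : Type*} [EuclideanDomain A] (p q : A) :
    ∃ d p' q' : A, p = d * p' ∧ q = d * q' ∧ IsCoprime p' q' := by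
  classical
  by_cases h : EuclideanDomain.gcd p q = 0
  · obtain ⟨rfl, rfl⟩ := EuclideanDomain.gcd_eq_zero_iff.1 h
    exact ⟨0, 1, 1, by simp, by simp, isCoprime_one_left⟩
  · obtain ⟨p', hp⟩ := EuclideanDomain.gcd_dvd_left p q
    obtain ⟨q', hq⟩ := EuclideanDomain.gcd_dvd_right p q
    refine ⟨_, p', q', hp, hq, EuclideanDomain.gcdA p q, EuclideanDomain.gcdB p q, ?_⟩
    have := EuclideanDomain.gcd_eq_gcd_ab p q
    refine mul_left_cancel₀ h ?_
    linear_combination -this - EuclideanDomain.gcdA p q * hp - EuclideanDomain.gcdB p q * hq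

/-- The algebra behind the decomposition into partial fractions. -/
lemma partial_fraction_identity {R : Type*} [CommRing R] {z a P Q D x y A B u v : R}
    (hP : P = D * x) (hQ : Q = D * y) (hA : P * A = 1) (hB : Q * B = 1) (h : u * x + v * y = 1)
    (ha : z * (P * Q) = a) : z = a * v * x * A ^ 2 + a * u * y * B ^ 2 := by
  subst hP hQ ha
  linear_combination -z * h - z * v * y * (D * x * A + 1) * hA - z * u * x * (D * y * B + 1) * hB

/-- Partial fractions: for open sets `V₁` and `V₂` in an affine open set whose ring is a quotient
of a Euclidean domain, each function on `V₁ ⊓ V₂` is a sum of functions on `V₁` and `V₂`. -/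
lemma exists_res_add_res {A : Type} [EuclideanDomain A] (hW : IsAffineOpen W)
    (ρ : A →+* Γ(X, W)) (hρ : Function.Surjective ρ) {V₁ V₂ : X.Opens} (h₁ : V₁ ≤ W)
    (h₂ : V₂ ≤ W) (z : Γ(X, V₁ ⊓ V₂)) :
    ∃ (a : Γ(X, V₁)) (b : Γ(X, V₂)), z = res inf_le_left a + res inf_le_right b := by
  have : IsPrincipalIdealRing Γ(X, W) := .of_surjective ρ hρ
  obtain ⟨f₁, rfl⟩ := exists_eq_basicOpen hW h₁
  obtain ⟨f₂, rfl⟩ := exists_eq_basicOpen hW h₂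
  obtain ⟨p₁, hp₁⟩ := hρ f₁
  obtain ⟨p₂, hp₂⟩ := hρ f₂
  obtain ⟨d, q₁, q₂, hd₁, hd₂, hq⟩ := exists_coprime_factorization p₁ p₂
  have hf₁ : f₁ = ρ d * ρ q₁ := by rw [← hp₁, hd₁, map_mul]
  have hf₂ : f₂ = ρ d * ρ q₂ := by rw [← hp₂, hd₂, map_mul]
  obtain ⟨i₁, hi₁⟩ : ∃ i, res (X.basicOpen_le f₁) f₁ * i = 1 := isUnit_iff_exists_inv.1
    (RingedSpace.isUnit_res_basicOpen X.toRingedSpace f₁)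
  obtain ⟨i₂, hi₂⟩ : ∃ i, res (X.basicOpen_le f₂) f₂ * i = 1 := isUnit_iff_exists_inv.1
    (RingedSpace.isUnit_res_basicOpen X.toRingedSpace f₂)
  have hle : X.basicOpen f₁ ⊓ X.basicOpen f₂ ≤ W := inf_le_left.trans h₁
  obtain ⟨n, a, ha⟩ : ∃ (n : ℕ) (a : Γ(X, W)), z * res hle (f₁ * f₂) ^ n = res hle a := by
    have hm := X.basicOpen_mul f₁ f₂
    have := hW.isLocalization_basicOpen (f₁ * f₂)
    obtain ⟨n, a, ha⟩ := IsLocalization.Away.surj (f₁ * f₂) (res hm.le z)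
    refine ⟨n, a, ?_⟩
    have ha' : res hm.le z * res (X.basicOpen_le _) (f₁ * f₂) ^ n = res (X.basicOpen_le _) a := ha
    have := congrArg (res hm.ge) ha'
    rw [map_mul, map_pow] at this
    simpa only [res_res, res_self] using this
  obtain ⟨u, v, huv⟩ := hq.pow (m := n) (n := n)
  let V := X.basicOpen f₁ ⊓ X.basicOpen f₂
  have e₁ : res (inf_le_left : V ≤ _) (res (X.basicOpen_le f₁) f₁) * res inf_le_left i₁ = 1 := by
    rw [← map_mul, hi₁, map_one]
  have e₂ : res (inf_le_right : V ≤ _) (res (X.basicOpen_le f₂) f₂) * res inf_le_right i₂ = 1 := by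
    rw [← map_mul, hi₂, map_one]
  rw [res_res] at e₁ e₂
  refine ⟨res h₁ (a * ρ v * ρ q₁ ^ n) * (i₁ ^ n) ^ 2,
    res h₂ (a * ρ u * ρ q₂ ^ n) * (i₂ ^ n) ^ 2, ?_⟩
  simp only [map_mul, map_pow, res_res]
  refine partial_fraction_identity (P := res hle f₁ ^ n) (Q := res hle f₂ ^ n)
    (D := res hle (ρ d) ^ n) ?_ ?_ ?_ ?_ ?_ ?_
  · exact (congrArg (fun y ↦ res hle y ^ n) hf₁).trans (by rw [map_mul, mul_pow])
  · exact (congrArg (fun y ↦ res hle y ^ n) hf₂).trans (by rw [map_mul, mul_pow])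
  · rw [← mul_pow, e₁, one_pow]
  · rw [← mul_pow, e₂, one_pow]
  · simp only [← map_mul, ← map_pow, ← map_add, huv, map_one]
  · rw [← ha, map_mul, mul_pow]

/-- If the kernel of an epimorphism is free of rank one over an affine open set `W` whose ring is a
quotient of a Euclidean domain, the epimorphism is surjective on sections over `W`. Local lifts
over two open subsets are corrected by partial fractions to agree on the overlap, and `W` is
compact. -/
lemma exists_lift_of_isAffineOpen {S : ShortComplex X.Modules} (hS : S.ShortExact)
    {A : Type} [EuclideanDomain A] (hW : IsAffineOpen W)
    (ρ : A →+* Γ(X, W)) (hρ : Function.Surjective ρ) (e : Γ(S.X₁, W))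
    (he : ∀ (V : X.Opens) (h : V ≤ W) (s : Γ(S.X₁, V)), ∃ r : Γ(X, V), s = r • secRes _ h e)
    (s : Γ(S.X₃, W)) : ∃ t : Γ(S.X₂, W), S.g.app W t = s := by
  let p : Set X → Prop := fun C ↦ ∃ (V : X.Opens) (h : V ≤ W), C ⊆ V ∧
    ∃ t : Γ(S.X₂, V), S.g.app V t = secRes _ h s
  have : p W := by
    refine hW.isCompact.induction_on ⟨⊥, bot_le, by simp, 0, ?_⟩ ?_ ?_ ?_
    · rw [map_zero]
      exact sec_ext (fun i : Empty ↦ i.elim) ⊥ (fun i ↦ i.elim) (by simp) (fun i ↦ i.elim)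
    · rintro C C' h ⟨V, hV, hC, ht⟩
      exact ⟨V, hV, h.trans hC, ht⟩
    · rintro C₁ C₂ ⟨V₁, h₁, hC₁, t₁, ht₁⟩ ⟨V₂, h₂, hC₂, t₂, ht₂⟩
      refine ⟨V₁ ⊔ V₂, sup_le h₁ h₂, Set.union_subset_union hC₁ hC₂, ?_⟩
      obtain ⟨δ, hδ⟩ := exists_app_eq_of_exact hS (V₁ ⊓ V₂)
        (secRes _ inf_le_left t₁ - secRes _ inf_le_right t₂) (by
          rw [map_sub, app_secRes, app_secRes, ht₁, ht₂, secRes_secRes, secRes_secRes, sub_self])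
      obtain ⟨r, rfl⟩ := he _ (inf_le_left.trans h₁) δ
      obtain ⟨a, b, rfl⟩ := exists_res_add_res hW ρ hρ h₁ h₂ r
      obtain ⟨t, ht, ht'⟩ := exists_glue₂ (le_sup_left : V₁ ≤ V₁ ⊔ V₂) le_sup_right le_rfl
        (t₁ - S.f.app V₁ (a • secRes _ h₁ e)) (t₂ + S.f.app V₂ (b • secRes _ h₂ e)) (by
          rw [map_sub, map_add, ← app_secRes, ← app_secRes, secRes_smul, secRes_smul,
            secRes_secRes, secRes_secRes, sub_eq_iff_eq_add, add_assoc, ← map_add,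
            ← sub_eq_iff_eq_add', ← hδ, add_smul, add_comm])
      have hz (V : X.Opens) (y : Γ(S.X₁, V)) : S.g.app V (S.f.app V y) = 0 := by
        rw [← comp_app_apply, S.zero]; rfl
      refine ⟨t, sec_ext₂ (le_sup_left : V₁ ≤ V₁ ⊔ V₂) le_sup_right le_rfl ?_ ?_⟩
      · rw [← app_secRes, ht, map_sub, hz, sub_zero, ht₁, secRes_secRes]
      · rw [← app_secRes, ht', map_add, hz, add_zero, ht₂, secRes_secRes]
    · intro x hx
      have := hS.epi_g
      obtain ⟨V, h, hxV, t, ht⟩ := exists_local_lift_of_epi S.g s x hx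
      exact ⟨V, mem_nhdsWithin_of_mem_nhds (V.isOpen.mem_nhds hxV), V, h, subset_rfl, t, ht⟩
  obtain ⟨V, h, hC, t, ht⟩ := this
  obtain rfl : V = W := le_antisymm h hC
  exact ⟨t, by rw [ht, secRes_self]⟩

end

/-! ### Functions on the charts of the projective line -/

section

attribute [local instance] MvPolynomial.gradedAlgebra

/-- The structure morphism to the spectrum of the ring of constants, on a basic open set. -/
lemma ι_toSpecZero (f : MvPolynomial (Fin 2) ℂ) :
    (Proj.basicOpen homogPoly f).ι ≫ Proj.toSpecZero homogPoly =
      (Proj.basicOpen homogPoly f).toSpecΓ ≫ Spec.map (CommRingCat.ofHom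
        (HomogeneousLocalization.fromZeroRingHom homogPoly _) ≫
          Proj.awayToSection homogPoly f) := by
  rw [Proj.toSpecZero, Proj.basicOpenToSpec]
  simp only [Category.assoc]
  have (U) (e : U = ⊤) : (Proj.basicOpen homogPoly f).ι ≫ (Scheme.topIso _).inv ≫
      (Scheme.isoOfEq _ e).inv = Scheme.homOfLE _ (le_top.trans_eq e.symm) := by
    simp only [← Category.assoc, Iso.comp_inv_eq]
    simp only [Scheme.topIso_hom, Category.assoc, Scheme.isoOfEq_hom_ι, Scheme.homOfLE_ι]
  rw [reassoc_of% this, ← Scheme.Opens.toSpecΓ_SpecMap_presheaf_map_assoc,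
    ← Spec.map_comp, ← Spec.map_comp]
  rfl

/-- The constant functions restrict to the fractions of degree zero with constant numerator and
denominator `1`. -/
lemma toSpecZero_appTop_res (f : MvPolynomial (Fin 2) ℂ) :
    ((Scheme.ΓSpecIso (.of (homogPoly 0))).inv ≫ (Proj.toSpecZero homogPoly).appTop) ≫
      P1.presheaf.map (homOfLE (le_top : Proj.basicOpen homogPoly f ≤ ⊤)).op =
    CommRingCat.ofHom (HomogeneousLocalization.fromZeroRingHom homogPoly _) ≫
      Proj.awayToSection homogPoly f := by
  have h := congrArg (fun k ↦ (Scheme.ΓSpecIso (.of (homogPoly 0))).inv ≫ Scheme.Hom.appTop k ≫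
    (Proj.basicOpen homogPoly f).topIso.hom) (ι_toSpecZero f)
  simp only [Scheme.Hom.comp_appTop, Scheme.Opens.toSpecΓ_appTop, Category.assoc,
    Iso.inv_hom_id, Category.comp_id] at h
  rw [Scheme.ΓSpecIso_naturality, Iso.inv_hom_id_assoc] at h
  rw [← h, Category.assoc]
  congr 2

lemma D_sup : D 0 ⊔ D 1 = ⊤ := by
  have := Proj.iSup_basicOpen_eq_top' homogPoly (fun i : Fin 2 ↦ MvPolynomial.X i)
    (fun i ↦ ⟨1, X_mem i⟩) ?_
  · rw [eq_top_iff, ← this]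
    refine iSup_le fun i ↦ ?_
    fin_cases i
    exacts [le_sup_left, le_sup_right]
  · rw [eq_top_iff]
    rintro p -
    induction p using MvPolynomial.induction_on with
    | C a =>
      exact Subalgebra.algebraMap_mem _
        (⟨MvPolynomial.C a, MvPolynomial.isHomogeneous_C _ a⟩ : homogPoly 0)
    | add p q hp hq => exact add_mem hp hq
    | mul_X p i hp => exact mul_mem hp (Algebra.subset_adjoin ⟨i, rfl⟩)

/-- The constant functions on an open set. -/
def const (V : P1.Opens) : ℂ →+* Γ(P1, V) := (res le_top).comp scalars

lemma res_const {V W : P1.Opens} (h : V ≤ W) (c : ℂ) : res h (const W c) = const V c :=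
  res_res _ _ _

/-- A constant, as a fraction of degree zero. -/
def constFrac (f : MvPolynomial (Fin 2) ℂ) : ℂ →+* HomogeneousLocalization.Away homogPoly f :=
  (HomogeneousLocalization.fromZeroRingHom homogPoly _).comp (algebraMap ℂ (homogPoly 0))

lemma const_eq_awayToSection (f : MvPolynomial (Fin 2) ℂ) (c : ℂ) :
    const (Proj.basicOpen homogPoly f) c = Proj.awayToSection homogPoly f (constFrac f c) :=
  congrArg (fun k ↦ k.hom (algebraMap ℂ (homogPoly 0) c)) (toSpecZero_appTop_res f)

/-- The polynomial functions in the coordinate `X j / X i` on the chart `D i`. -/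
def polyChart (i j : Fin 2) : Polynomial ℂ →+* Γ(P1, D i) :=
  Polynomial.eval₂RingHom (const (D i)) (coordQuot i j)

/-- The fraction of degree zero obtained by evaluating a polynomial at `X j / X i`. -/
def polyFrac (i j : Fin 2) :
    Polynomial ℂ →+*
      HomogeneousLocalization.Away homogPoly (MvPolynomial.X i : MvPolynomial (Fin 2) ℂ) :=
  Polynomial.eval₂RingHom (constFrac _) (coordFrac i j)

lemma polyChart_eq (i j : Fin 2) (p : Polynomial ℂ) :
    polyChart i j p = Proj.awayToSection homogPoly _ (polyFrac i j p) := by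
  have : polyChart i j = (Proj.awayToSection homogPoly _).hom.comp (polyFrac i j) := by
    refine Polynomial.ringHom_ext (fun c ↦ ?_) ?_
    · simp only [polyChart, polyFrac, Polynomial.coe_eval₂RingHom, RingHom.comp_apply,
        Polynomial.eval₂_C]
      exact const_eq_awayToSection _ c
    · simp only [polyChart, polyFrac, Polynomial.coe_eval₂RingHom, RingHom.comp_apply,
        Polynomial.eval₂_X]
      rfl
  rw [this]; rfl

/-- Scaling the variables by `x` scales the values of a form of degree `n` by `x ^ n`. -/
lemma isHomogeneous_eval₂_mul {σ R S : Type*} [CommSemiring R] [CommSemiring S] {n : ℕ}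
    {p : MvPolynomial σ R} (hp : p.IsHomogeneous n) (f : R →+* S) (x : S) (q : σ → S) :
    p.eval₂ f (fun k ↦ x * q k) = x ^ n * p.eval₂ f q := by
  rw [MvPolynomial.eval₂_eq, MvPolynomial.eval₂_eq, Finset.mul_sum]
  refine Finset.sum_congr rfl fun d hd ↦ ?_
  simp only [mul_pow, Finset.prod_mul_distrib]
  rw [Finset.prod_pow_eq_pow_sum, mul_left_comm, hp.degree_eq_sum_deg_support hd]

lemma val_coordFrac_mul (i j : Fin 2) :
    algebraMap (MvPolynomial (Fin 2) ℂ)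
        (Localization.Away (MvPolynomial.X i : MvPolynomial (Fin 2) ℂ))
      (MvPolynomial.X i) * (coordFrac i j).val =
      algebraMap _ _ (MvPolynomial.X j : MvPolynomial (Fin 2) ℂ) := by
  rw [coordFrac, HomogeneousLocalization.Away.val_mk, ← Localization.mk_one_eq_algebraMap,
    ← Localization.mk_one_eq_algebraMap, Localization.mk_mul, Localization.mk_eq_mk_iff,
    Localization.r_iff_exists]
  exact ⟨1, by simp [mul_comm]⟩

/-- Dehomogenization: a fraction `F / (X i) ^ n` of degree zero is a polynomial in `X j / X i`. -/
lemma polyFrac_surjective {i j : Fin 2} (hij : j ≠ i) : Function.Surjective (polyFrac i j) := by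
  intro z
  obtain ⟨n, a, ha, rfl⟩ := HomogeneousLocalization.Away.mk_surjective homogPoly (X_mem i) z
  let F : MvPolynomial (Fin 2) ℂ →+* Polynomial ℂ :=
    MvPolynomial.eval₂Hom Polynomial.C fun k ↦ if k = i then 1 else Polynomial.X
  refine ⟨F a, HomogeneousLocalization.val_injective _ ?_⟩
  let L := Localization.Away (MvPolynomial.X i : MvPolynomial (Fin 2) ℂ)
  let ι : MvPolynomial (Fin 2) ℂ →+* L := algebraMap _ _
  let v : HomogeneousLocalization.Away homogPoly
      (MvPolynomial.X i : MvPolynomial (Fin 2) ℂ) →+* L := algebraMap _ _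
  let q : Fin 2 → L := fun k ↦ v (coordFrac i k)
  have h₁ : (v.comp (polyFrac i j)).comp F = MvPolynomial.eval₂Hom (ι.comp MvPolynomial.C) q := by
    refine MvPolynomial.ringHom_ext (fun c ↦ ?_) fun k ↦ ?_
    · simp [F, polyFrac]
      rfl
    · by_cases hk : k = i
      · subst hk
        simp only [RingHom.comp_apply, F, MvPolynomial.coe_eval₂Hom, MvPolynomial.eval₂_X, if_true,
          map_one, q]
        have := val_coordFrac_mul k k
        exact ((IsLocalization.Away.algebraMap_isUnit
          (S := L) (MvPolynomial.X k : MvPolynomial (Fin 2) ℂ)).mul_left_cancel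
            (this.trans (mul_one _).symm)).symm
      · have hkj : k = j := by omega
        subst hkj
        simp [F, hk, polyFrac, q]
  have h₂ : ι a = ι (MvPolynomial.X i) ^ n * v (polyFrac i j (F a)) := by
    have ha' : a.IsHomogeneous n := by simpa using ha
    have := isHomogeneous_eval₂_mul ha' (ι.comp MvPolynomial.C) (ι (MvPolynomial.X i)) q
    have e : (fun k ↦ ι (MvPolynomial.X i) * q k) = fun k ↦ ι (MvPolynomial.X k) :=
      funext fun k ↦ val_coordFrac_mul i k
    rw [e] at this
    have h₃ := RingHom.congr_fun h₁ a
    simp only [RingHom.comp_apply, MvPolynomial.coe_eval₂Hom] at h₃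
    rw [h₃, ← this]
    have h₄ : MvPolynomial.eval₂Hom (ι.comp MvPolynomial.C) (fun k ↦ ι (MvPolynomial.X k)) = ι :=
      MvPolynomial.ringHom_ext (fun c ↦ by simp) fun k ↦ by simp
    exact (RingHom.congr_fun h₄ a).symm
  rw [HomogeneousLocalization.Away.val_mk]
  change v _ = _
  rw [Localization.mk_eq_mk', eq_comm, IsLocalization.mk'_eq_iff_eq_mul]
  rw [mul_comm]
  refine h₂.trans ?_
  rw [map_pow]

lemma isAffineOpen_D (i : Fin 2) : IsAffineOpen (D i) :=
  Proj.isAffineOpen_basicOpen homogPoly _ (X_mem i) one_pos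

lemma awayToSection_bijective {f : MvPolynomial (Fin 2) ℂ} {m : ℕ} (hf : f ∈ homogPoly m)
    (hm : 0 < m) : Function.Bijective (Proj.awayToSection homogPoly f) :=
  ConcreteCategory.bijective_of_isIso (Proj.basicOpenIsoAway homogPoly f hf hm).hom

lemma polyChart_surjective {i j : Fin 2} (hij : j ≠ i) : Function.Surjective (polyChart i j) := by
  intro z
  obtain ⟨y, rfl⟩ := (awayToSection_bijective (X_mem i) one_pos).2 z
  obtain ⟨p, rfl⟩ := polyFrac_surjective hij y
  exact ⟨p, polyChart_eq i j p⟩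

/-- The coordinate `x / y` on the overlap of the charts. -/
abbrev u : Γ(P1, D 0 ⊓ D 1) := ratio

/-- Polynomials in `x / y` on the overlap of the charts. -/
def polyOverlap : Polynomial ℂ →+* Γ(P1, D 0 ⊓ D 1) :=
  (res inf_le_right).comp (polyChart 1 0)

lemma overlap_eq : D 0 ⊓ D 1 = Proj.basicOpen homogPoly (MvPolynomial.X 1 * MvPolynomial.X 0) :=
  (inf_comm _ _).trans (Proj.basicOpen_mul _ _ _).symm

lemma awayToSection_awayMap {f g x : MvPolynomial (Fin 2) ℂ} {m : ℕ} (hg : g ∈ homogPoly m)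
    (hx : x = f * g) (a : HomogeneousLocalization.Away homogPoly f) :
    (Proj.awayToSection homogPoly x).hom (HomogeneousLocalization.awayMap homogPoly hg hx a) =
      res (Proj.basicOpen_mono _ _ _ ⟨_, hx⟩) ((Proj.awayToSection homogPoly f).hom a) :=
  congrArg (fun k ↦ k.hom a) (Proj.awayMap_awayToSection homogPoly hg hx)

/-- The map from fractions of degree zero with denominator a power of `y` to fractions of degree
zero with denominator a power of `y x`. -/
def fracOverlap :
    HomogeneousLocalization.Away homogPoly (MvPolynomial.X 1 : MvPolynomial (Fin 2) ℂ) →+*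
    HomogeneousLocalization.Away homogPoly
      (MvPolynomial.X 1 * MvPolynomial.X 0 : MvPolynomial (Fin 2) ℂ) :=
  HomogeneousLocalization.awayMap homogPoly (X_mem 0) rfl

lemma res_awayToSection_fracOverlap
    (a : HomogeneousLocalization.Away homogPoly (MvPolynomial.X 1 : MvPolynomial (Fin 2) ℂ)) :
    res overlap_eq.le ((Proj.awayToSection homogPoly _).hom (fracOverlap a)) =
      res (inf_le_right : D 0 ⊓ D 1 ≤ D 1) ((Proj.awayToSection homogPoly _).hom a) := by
  rw [fracOverlap, awayToSection_awayMap, res_res]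

lemma res_injective_of_eq {X : Scheme.{0}} {V W : X.Opens} (h : V = W) :
    Function.Injective (res h.le : Γ(X, W) → Γ(X, V)) := by
  intro s t hst
  have := congrArg (res h.ge) hst
  rwa [res_res, res_res, res_self, res_self] at this

lemma awayToSection_overlap_bijective : Function.Bijective (Proj.awayToSection homogPoly
    (MvPolynomial.X 1 * MvPolynomial.X 0 : MvPolynomial (Fin 2) ℂ)).hom :=
  awayToSection_bijective (m := 2) (SetLike.mul_mem_graded (X_mem 1) (X_mem 0)) two_pos

lemma val_fracOverlap_coordFrac : (fracOverlap (coordFrac 1 0)).val =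
    Localization.mk (MvPolynomial.X 0 * MvPolynomial.X 0)
      (⟨MvPolynomial.X 1 * MvPolynomial.X 0, ⟨1, pow_one _⟩⟩ : Submonoid.powers
        (MvPolynomial.X 1 * MvPolynomial.X 0 : MvPolynomial (Fin 2) ℂ)) := by
  rw [fracOverlap, coordFrac, HomogeneousLocalization.Away.mk,
    HomogeneousLocalization.val_awayMap_mk, Localization.mk_eq_mk_iff, Localization.r_iff_exists]
  exact ⟨1, by simp⟩

lemma fracOverlap_constFrac (c : ℂ) : fracOverlap (constFrac _ c) = constFrac _ c :=
  HomogeneousLocalization.awayMap_fromZeroRingHom ..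

/-- Substituting `x = T` and `y = 1` shows that polynomials in `x / y` are independent. -/
lemma fracOverlap_polyFrac_injective : Function.Injective (fracOverlap.comp (polyFrac 1 0)) := by
  let K := FractionRing (Polynomial ℂ)
  let ev : MvPolynomial (Fin 2) ℂ →+* K := (algebraMap (Polynomial ℂ) K).comp
    (MvPolynomial.eval₂Hom Polynomial.C ![Polynomial.X, 1])
  have hev : IsUnit (ev (MvPolynomial.X 1 * MvPolynomial.X 0)) := by
    have : algebraMap (Polynomial ℂ) K Polynomial.X ≠ 0 :=
      (map_ne_zero_iff _ (IsFractionRing.injective (Polynomial ℂ) K)).2 Polynomial.X_ne_zero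
    have e : ev (MvPolynomial.X 1 * MvPolynomial.X 0) =
        algebraMap (Polynomial ℂ) K Polynomial.X := by
      simp [ev]
    rw [e]
    exact IsUnit.mk0 _ this
  let φ : Localization.Away (MvPolynomial.X 1 * MvPolynomial.X 0 : MvPolynomial (Fin 2) ℂ) →+* K :=
    IsLocalization.Away.lift _ hev
  let v : HomogeneousLocalization.Away homogPoly
      (MvPolynomial.X 1 * MvPolynomial.X 0 : MvPolynomial (Fin 2) ℂ) →+*
        Localization.Away (MvPolynomial.X 1 * MvPolynomial.X 0 : MvPolynomial (Fin 2) ℂ) :=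
    algebraMap _ _
  have h : (φ.comp v).comp (fracOverlap.comp (polyFrac 1 0)) = algebraMap (Polynomial ℂ) K := by
    refine Polynomial.ringHom_ext (fun c ↦ ?_) ?_
    · simp only [polyFrac, RingHom.comp_apply, Polynomial.coe_eval₂RingHom, Polynomial.eval₂_C,
        fracOverlap_constFrac]
      exact (IsLocalization.Away.lift_eq _ hev _).trans
        (congrArg (algebraMap (Polynomial ℂ) K) (MvPolynomial.eval₂_C _ _ c))
    · simp only [polyFrac, RingHom.comp_apply, Polynomial.coe_eval₂RingHom, Polynomial.eval₂_X]
      have h₁ : algebraMap _ _ (MvPolynomial.X 1 * MvPolynomial.X 0 : MvPolynomial (Fin 2) ℂ) *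
          v (fracOverlap (coordFrac 1 0)) =
          algebraMap _ _ (MvPolynomial.X 0 * MvPolynomial.X 0 : MvPolynomial (Fin 2) ℂ) := by
        refine (congrArg (_ * ·) val_fracOverlap_coordFrac).trans ?_
        rw [← Localization.mk_one_eq_algebraMap, ← Localization.mk_one_eq_algebraMap,
          Localization.mk_mul, Localization.mk_eq_mk_iff, Localization.r_iff_exists]
        exact ⟨1, by simp⟩
      have h₂ := congrArg φ h₁
      rw [map_mul, IsLocalization.Away.lift_eq, IsLocalization.Away.lift_eq] at h₂
      refine hev.mul_left_cancel (h₂.trans ?_)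
      simp [ev]
  refine Function.Injective.of_comp (f := φ.comp v) ?_
  rw [← RingHom.coe_comp, h]
  exact IsFractionRing.injective (Polynomial ℂ) K

lemma polyOverlap_eq (p : Polynomial ℂ) : polyOverlap p =
    res overlap_eq.le ((Proj.awayToSection homogPoly _).hom (fracOverlap (polyFrac 1 0 p))) := by
  rw [res_awayToSection_fracOverlap, polyOverlap, RingHom.comp_apply, polyChart_eq]

lemma polyOverlap_injective : Function.Injective polyOverlap := by
  intro p p' h
  rw [polyOverlap_eq, polyOverlap_eq] at h
  exact fracOverlap_polyFrac_injective
    (awayToSection_overlap_bijective.1 (res_injective_of_eq overlap_eq h))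

/-- Functions on the overlap of the charts are Laurent polynomials in `x / y`. -/
lemma exists_mul_pow_eq_polyOverlap (z : Γ(P1, D 0 ⊓ D 1)) :
    ∃ (n : ℕ) (p : Polynomial ℂ), z * u ^ n = polyOverlap p := by
  obtain ⟨y, hy⟩ : ∃ y : HomogeneousLocalization.Away homogPoly
      (MvPolynomial.X 1 * MvPolynomial.X 0 : MvPolynomial (Fin 2) ℂ), _ =  _ :=
    awayToSection_overlap_bijective.2 (res overlap_eq.ge z)
  let := fracOverlap.toAlgebra
  have hloc : IsLocalization.Away
      (HomogeneousLocalization.Away.isLocalizationElem (X_mem 1) (X_mem 0))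
      (HomogeneousLocalization.Away homogPoly
        (MvPolynomial.X 1 * MvPolynomial.X 0 : MvPolynomial (Fin 2) ℂ)) :=
    HomogeneousLocalization.Away.isLocalization_mul (X_mem 1) (X_mem 0)
    (x := MvPolynomial.X 1 * MvPolynomial.X 0) rfl one_ne_zero
  obtain ⟨n, a, ha⟩ := IsLocalization.Away.surj
    (HomogeneousLocalization.Away.isLocalizationElem (X_mem 1) (X_mem 0)) y
  obtain ⟨p, rfl⟩ := polyFrac_surjective (by decide : (0 : Fin 2) ≠ 1) a
  refine ⟨n, p, ?_⟩
  have ht : HomogeneousLocalization.Away.isLocalizationElem (X_mem 1) (X_mem 0) =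
      coordFrac 1 0 := by
    apply HomogeneousLocalization.val_injective
    simp [coordFrac]
  rw [ht] at ha
  have ha' : y * fracOverlap (coordFrac 1 0) ^ n = fracOverlap (polyFrac 1 0 p) := ha
  have := congrArg (fun w ↦ res overlap_eq.le ((Proj.awayToSection homogPoly _).hom w)) ha'
  simp only [map_mul, map_pow, hy] at this
  rw [res_res, res_self] at this
  have hu : u = res overlap_eq.le ((Proj.awayToSection homogPoly _).hom
    (fracOverlap (coordFrac 1 0))) := (res_awayToSection_fracOverlap _).symm
  rw [hu, polyOverlap_eq]
  exact this

end

/-! ### Morphisms between the line bundles -/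

section

lemma polyOverlap_apply (p : Polynomial ℂ) :
    polyOverlap p = p.eval₂ (const _) (u : Γ(P1, D 0 ⊓ D 1)) := by
  have : polyOverlap = Polynomial.eval₂RingHom (const _) (u : Γ(P1, D 0 ⊓ D 1)) := by
    refine Polynomial.ringHom_ext (fun c ↦ ?_) ?_
    · simp [polyOverlap, polyChart, res_const]
    · simp [polyOverlap, polyChart]
      rfl
  rw [this]; rfl

/-- On the overlap, a polynomial in `y / x` of degree at most `N` is a reflected polynomial in
`x / y` divided by `(x / y) ^ N`. -/
lemma res_polyChart_zero (p : Polynomial ℂ) {N : ℕ} (hN : p.natDegree ≤ N) :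
    res inf_le_left (polyChart 0 1 p) * u ^ N = polyOverlap (p.reflect N) := by
  have h : res (inf_le_left : D 0 ⊓ D 1 ≤ D 0) (polyChart 0 1 p) =
      p.eval₂ (const _) ((ratio⁻¹ : Γ(P1, D 0 ⊓ D 1)ˣ) : Γ(P1, D 0 ⊓ D 1)) := by
    have : (res (inf_le_left : D 0 ⊓ D 1 ≤ D 0)).comp (polyChart 0 1) =
        Polynomial.eval₂RingHom (const _)
          ((ratio⁻¹ : Γ(P1, D 0 ⊓ D 1)ˣ) : Γ(P1, D 0 ⊓ D 1)) := by
      refine Polynomial.ringHom_ext (fun c ↦ ?_) ?_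
      · simp [polyChart, res_const]
      · simp [polyChart]
        rfl
    exact RingHom.congr_fun this p
  have : Invertible (u : Γ(P1, D 0 ⊓ D 1)) := ratio.invertible
  rw [h, polyOverlap_apply, ← Polynomial.eval₂_reflect_mul_pow _ u N (p.reflect N)
    (Polynomial.natDegree_reflect_le.trans (by simp [hN])), Polynomial.reflect_reflect]
  exact congrArg (fun v ↦ p.eval₂ _ v * _) (invOf_units ratio).symm

/-- Functions on the overlap are sums of polynomials in `y / x` and of `x / y` times polynomials in
`x / y`: this is the vanishing of `H¹(𝒪(-1))`. -/
lemma exists_eq_mul_res_add_res (z : Γ(P1, D 0 ⊓ D 1)) :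
    ∃ (a₀ : Γ(P1, D 0)) (a₁ : Γ(P1, D 1)),
      z = u * res inf_le_right a₁ + res inf_le_left a₀ := by
  obtain ⟨n, p, hp⟩ := exists_mul_pow_eq_polyOverlap z
  let m : Polynomial ℂ := Polynomial.X ^ (n + 1)
  have hm : m.Monic := Polynomial.monic_X_pow _
  have hr : (p %ₘ m).natDegree ≤ n := by
    have hd : m.natDegree = n + 1 := Polynomial.natDegree_X_pow _
    have h1 : m ≠ 1 := fun h ↦ by rw [h, Polynomial.natDegree_one] at hd; omega
    have := Polynomial.natDegree_modByMonic_lt p hm h1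
    omega
  refine ⟨polyChart 0 1 ((p %ₘ m).reflect n), polyChart 1 0 (p /ₘ m), ?_⟩
  have h₀ := res_polyChart_zero ((p %ₘ m).reflect n) (N := n)
    (Polynomial.natDegree_reflect_le.trans (by simp [hr]))
  rw [Polynomial.reflect_reflect] at h₀
  have h₁ : res (inf_le_right : D 0 ⊓ D 1 ≤ D 1) (polyChart 1 0 (p /ₘ m)) =
    polyOverlap (p /ₘ m) := rfl
  have h₂ : polyOverlap m = u ^ (n + 1) := by simp [m, polyOverlap_apply]
  have hu : IsUnit ((u : Γ(P1, D 0 ⊓ D 1)) ^ n) := (ratio ^ n).isUnit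
  refine hu.mul_right_cancel ?_
  rw [hp, add_mul, h₀, h₁]
  conv_lhs => rw [← Polynomial.modByMonic_add_div p m]
  rw [map_add, map_mul, h₂]
  ring

/-- The vanishing of `H⁰(𝒪(-1))`. -/
lemma eq_zero_of_res_eq_mul_res {a₀ : Γ(P1, D 0)} {a₁ : Γ(P1, D 1)}
    (h : res (inf_le_left : D 0 ⊓ D 1 ≤ _) a₀ = u * res inf_le_right a₁) : a₀ = 0 ∧ a₁ = 0 := by
  obtain ⟨p, rfl⟩ := polyChart_surjective (by decide : (1 : Fin 2) ≠ 0) a₀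
  obtain ⟨q, rfl⟩ := polyChart_surjective (by decide : (0 : Fin 2) ≠ 1) a₁
  set N := p.natDegree
  have h₀ := res_polyChart_zero p (N := N) le_rfl
  have h₁ : polyOverlap (p.reflect N) = polyOverlap (q * Polynomial.X ^ (N + 1)) := by
    rw [← h₀, h, map_mul, map_pow]
    have : polyOverlap Polynomial.X = u := by simp [polyOverlap_apply]
    rw [this, pow_succ]
    change u * polyOverlap q * _ = _
    ring
  have h₂ := polyOverlap_injective h₁
  have hq : q = 0 := by
    by_contra hq
    have := congrArg Polynomial.natDegree h₂
    rw [Polynomial.natDegree_mul_X_pow _ hq] at this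
    have h₃ : (p.reflect N).natDegree ≤ N := Polynomial.natDegree_reflect_le.trans (by simp [N])
    omega
  subst hq
  rw [zero_mul, Polynomial.reflect_eq_zero_iff] at h₂
  rw [h₂, map_zero, map_zero]
  exact ⟨rfl, rfl⟩

/-- Functions on the charts that agree on the overlap are constant. -/
lemma exists_const_of_res_eq_res {a₀ : Γ(P1, D 0)} {a₁ : Γ(P1, D 1)}
    (h : res (inf_le_left : D 0 ⊓ D 1 ≤ _) a₀ = res inf_le_right a₁) :
    ∃ c, a₀ = const _ c ∧ a₁ = const _ c := by
  obtain ⟨p, rfl⟩ := polyChart_surjective (by decide : (1 : Fin 2) ≠ 0) a₀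
  obtain ⟨q, rfl⟩ := polyChart_surjective (by decide : (0 : Fin 2) ≠ 1) a₁
  set N := p.natDegree with hN
  have h₀ := res_polyChart_zero p (N := N) le_rfl
  have h₁ : polyOverlap (p.reflect N) = polyOverlap (q * Polynomial.X ^ N) := by
    rw [← h₀, h, map_mul, map_pow]
    have : polyOverlap Polynomial.X = u := by simp [polyOverlap_apply]
    rw [this]
    rfl
  have h₂ := polyOverlap_injective h₁
  have hq : q.natDegree = 0 := by
    by_cases hq : q = 0
    · simp [hq]
    have := congrArg Polynomial.natDegree h₂
    rw [Polynomial.natDegree_mul_X_pow _ hq] at this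
    have h₃ : (p.reflect N).natDegree ≤ N := Polynomial.natDegree_reflect_le.trans (by simp [N])
    omega
  obtain ⟨c, rfl⟩ := Polynomial.natDegree_eq_zero.1 hq
  have hp : p = Polynomial.C c := by
    rw [← Polynomial.reflect_reflect (N := N) (p := p), h₂, Polynomial.reflect_C_mul_X_pow]
    simp
  rw [hp]
  exact ⟨c, by simp [polyChart], by simp [polyChart]⟩

/-- The generator of `𝒪(n)` over the chart `D 0`. -/
abbrev e₀ (n : ℤ) : Γ(O n, D 0) := gen₀ (D 0) (D 1) (ratio ^ n)

/-- The generator of `𝒪(n)` over the chart `D 1`. -/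
abbrev e₁ (n : ℤ) : Γ(O n, D 1) := gen₁ (D 0) (D 1) (ratio ^ n)

lemma exists_eq_smul_e₀ (n : ℤ) (V : P1.Opens) (h : V ≤ D 0) (s : Γ(O n, V)) :
    ∃ r : Γ(P1, V), s = r • secRes _ h (e₀ n) := by
  refine ⟨_, Eq.trans (secRes_self le_rfl s).symm (secRes_eq_smul_gen₀ le_rfl h s)⟩

lemma exists_eq_smul_e₁ (n : ℤ) (V : P1.Opens) (h : V ≤ D 1) (s : Γ(O n, V)) :
    ∃ r : Γ(P1, V), s = r • secRes _ h (e₁ n) := by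
  refine ⟨_, Eq.trans (secRes_self le_rfl s).symm (secRes_eq_smul_gen₁ le_rfl h s)⟩

lemma smul_e₁_injective (n : ℤ) {V : P1.Opens} (h : V ≤ D 1) {r r' : Γ(P1, V)}
    (hr : r • secRes (O n) h (e₁ n) = r' • secRes _ h (e₁ n)) : r = r' := by
  have e (r : Γ(P1, V)) : (toPair (r • secRes (O n) h (e₁ n))).1.2 = res inf_le_left r := by
    change res _ r * res _ 1 = _
    rw [map_one, mul_one]
  have := (e r).symm.trans ((congrArg (fun s ↦ (toPair s).1.2) hr).trans (e r'))
  have := congrArg (res (le_inf le_rfl h)) this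
  rwa [res_res, res_res, res_self, res_self] at this

lemma secRes_e₀ (n : ℤ) : secRes (O n) (inf_le_left : D 0 ⊓ D 1 ≤ D 0) (e₀ n) =
    ((ratio ^ n : Γ(P1, D 0 ⊓ D 1)ˣ) : Γ(P1, D 0 ⊓ D 1)) • secRes _ inf_le_right (e₁ n) :=
  (secRes_gen₀ (U₀ := D 0) (U₁ := D 1) (g := ratio ^ n) inf_le_left inf_le_right).trans
    (congrArg (· • secRes (O n) inf_le_right (e₁ n)) (res_self _ _))

/-- A morphism from `𝒪(m)` to `𝒪(n)` is given by functions on the charts. -/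
lemma exists_coeff {m n : ℤ} (f : O m ⟶ O n) : ∃ (a₀ : Γ(P1, D 0)) (a₁ : Γ(P1, D 1)),
    f.app _ (e₀ m) = a₀ • e₀ n ∧ f.app _ (e₁ m) = a₁ • e₁ n ∧
    res inf_le_left a₀ * ((ratio ^ n : Γ(P1, D 0 ⊓ D 1)ˣ) : Γ(P1, D 0 ⊓ D 1)) =
      ((ratio ^ m : Γ(P1, D 0 ⊓ D 1)ˣ) : Γ(P1, D 0 ⊓ D 1)) * res inf_le_right a₁ := by
  obtain ⟨a₀, h₀⟩ := exists_eq_smul_e₀ n _ le_rfl (f.app _ (e₀ m))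
  obtain ⟨a₁, h₁⟩ := exists_eq_smul_e₁ n _ le_rfl (f.app _ (e₁ m))
  rw [secRes_self] at h₀ h₁
  refine ⟨a₀, a₁, h₀, h₁, ?_⟩
  have h := congrArg (f.app _) (secRes_e₀ m)
  rw [Scheme.Modules.Hom.app_smul, app_secRes, app_secRes, h₀, h₁, secRes_smul, secRes_smul,
    secRes_e₀, smul_smul, smul_smul] at h
  exact smul_e₁_injective _ _ h

lemma hom_eq_zero (f : O (-1) ⟶ O (-2)) : f = 0 := by
  obtain ⟨a₀, a₁, h₀, h₁, h⟩ := exists_coeff f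
  have h' : res (inf_le_left : D 0 ⊓ D 1 ≤ _) a₀ = u * res inf_le_right a₁ := by
    have e : (ratio : Γ(P1, D 0 ⊓ D 1)ˣ) ^ (-1 : ℤ) = ratio ^ (-2 : ℤ) * ratio := by
      rw [← zpow_add_one]; rfl
    rw [e, Units.val_mul, mul_assoc, mul_comm] at h
    exact (ratio ^ (-2 : ℤ)).isUnit.mul_left_cancel h
  obtain ⟨rfl, rfl⟩ := eq_zero_of_res_eq_mul_res h'
  rw [zero_smul] at h₀ h₁
  exact glue_hom_ext D_sup h₀ h₁

lemma smul_app_apply {M N : P1.Modules} (c : ℂ) (f : M ⟶ N) {V : P1.Opens} (s : Γ(M, V)) :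
    (c • f).app V s = const V c • f.app V s := rfl

lemma exists_eq_smul_id {n : ℤ} (f : O n ⟶ O n) : ∃ c : ℂ, f = c • 𝟙 (O n) := by
  obtain ⟨a₀, a₁, h₀, h₁, h⟩ := exists_coeff f
  rw [mul_comm] at h
  obtain ⟨c, rfl, rfl⟩ := exists_const_of_res_eq_res ((ratio ^ n).isUnit.mul_left_cancel h)
  exact ⟨c, glue_hom_ext D_sup (h₀.trans (smul_app_apply c (𝟙 (O n)) (e₀ n)).symm)
    (h₁.trans (smul_app_apply c (𝟙 (O n)) (e₁ n)).symm)⟩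

lemma smul_id_eq_zero {n : ℤ} {c : ℂ} (h : c • 𝟙 (O n) = 0) : c = 0 := by
  have h₁ : const (D 1) c • e₁ n = 0 := by
    have := congrArg (fun f : O n ⟶ O n ↦ f.app _ (e₁ n)) h
    exact this
  have h₂ : const (D 1) c = 0 := smul_e₁_injective n le_rfl
    (by rw [zero_smul, secRes_self]; exact h₁)
  have h₃ : polyOverlap (Polynomial.C c) = polyOverlap 0 := by
    have : const (D 0 ⊓ D 1) c = 0 := by
      rw [← res_const (inf_le_right : D 0 ⊓ D 1 ≤ D 1), h₂, map_zero]
    simp [polyOverlap_apply, this]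
  exact Polynomial.C_eq_zero.1 (polyOverlap_injective h₃)

/-- Morphisms from `𝒪(-1)` lift along epimorphisms with kernel `𝒪(-2)`. -/
lemma exists_lift {I Q : P1.Modules} {i : O (-2) ⟶ I} {p : I ⟶ Q} {w : i ≫ p = 0}
    (hS : (ShortComplex.mk i p w).ShortExact) (f : O (-1) ⟶ Q) : ∃ f', f' ≫ p = f := by
  obtain ⟨t₀, ht₀⟩ := exists_lift_of_isAffineOpen hS (isAffineOpen_D 0) (polyChart 0 1)
    (polyChart_surjective (by decide)) (e₀ _) (exists_eq_smul_e₀ _) (f.app _ (e₀ _))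
  obtain ⟨t₁, ht₁⟩ := exists_lift_of_isAffineOpen hS (isAffineOpen_D 1) (polyChart 1 0)
    (polyChart_surjective (by decide)) (e₁ _) (exists_eq_smul_e₁ _) (f.app _ (e₁ _))
  dsimp only at t₀ t₁ ht₀ ht₁
  let g : Γ(P1, D 0 ⊓ D 1)ˣ := ratio ^ (-1 : ℤ)
  obtain ⟨δ, hδ⟩ := exists_app_eq_of_exact hS (D 0 ⊓ D 1)
    (secRes I inf_le_left t₀ - (g : Γ(P1, D 0 ⊓ D 1)) • secRes I inf_le_right t₁) (by
      dsimp only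
      rw [map_sub, Scheme.Modules.Hom.app_smul, app_secRes, app_secRes, ht₀, ht₁, ← app_secRes,
        ← app_secRes, secRes_e₀, Scheme.Modules.Hom.app_smul, sub_self])
  dsimp only at δ hδ
  obtain ⟨z, rfl⟩ := exists_eq_smul_e₀ _ _ inf_le_left δ
  obtain ⟨a₀, a₁, rfl⟩ := exists_eq_mul_res_add_res z
  have hz (V : P1.Opens) (y : Γ(O (-2), V)) : p.app V (i.app V y) = 0 := by
    rw [← comp_app_apply, w]; rfl
  have hg : (g : Γ(P1, D 0 ⊓ D 1)) =
      u * ((ratio ^ (-2 : ℤ) : Γ(P1, D 0 ⊓ D 1)ˣ) : Γ(P1, D 0 ⊓ D 1)) := by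
    have e : (ratio : Γ(P1, D 0 ⊓ D 1)ˣ) ^ (-1 : ℤ) = ratio * ratio ^ (-2 : ℤ) := by
      rw [← zpow_one_add]; rfl
    rw [← Units.val_mul, ← e]
  have key : secRes I (inf_le_left : D 0 ⊓ D 1 ≤ D 0) (t₀ - i.app _ (a₀ • e₀ _)) =
      (g : Γ(P1, D 0 ⊓ D 1)) • secRes I inf_le_right (t₁ + i.app _ (a₁ • e₁ _)) := by
    rw [map_sub, map_add, smul_add, sub_eq_iff_eq_add, add_assoc, ← sub_eq_iff_eq_add', ← hδ,
      ← app_secRes, ← app_secRes, ← Scheme.Modules.Hom.app_smul, ← map_add, add_smul,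
      secRes_smul, secRes_smul]
    congr 2
    rw [secRes_e₀, smul_smul, smul_smul, hg]
    congr 1
    ring
  let f' : O (-1) ⟶ I := glueDesc D_sup _ _ key
  have h₀ : f'.app _ (e₀ _) = _ := glueDesc_gen₀ D_sup _ _ key
  have h₁ : f'.app _ (e₁ _) = _ := glueDesc_gen₁ D_sup _ _ key
  refine ⟨f', glue_hom_ext D_sup ?_ ?_⟩
  · exact (congrArg (p.app _) h₀).trans (by rw [map_sub, hz, sub_zero, ht₀]; rfl)
  · exact (congrArg (p.app _) h₁).trans (by rw [map_add, hz, add_zero, ht₁]; rfl)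

end

/-! ### Extension classes in abelian categories -/

section

section Abelian

open Abelian Pretriangulated

variable {C : Type*} [Category* C] [Abelian C] {X Y : C}

section Pushout

variable {S : ShortComplex C} (hS : S.ShortExact) (φ : S.X₁ ⟶ Y)

/-- The pushout of a short exact sequence along a morphism `φ` from its first term. -/
abbrev pushoutSeq (S : ShortComplex C) (φ : S.X₁ ⟶ Y) : ShortComplex C :=
  ShortComplex.mk (biprod.inl ≫ cokernel.π (biprod.lift φ S.f))
    (cokernel.desc (biprod.lift φ S.f) (biprod.desc 0 S.g) (by simp)) (by simp)

include hS

lemma mono_biprod_lift : Mono (biprod.lift φ S.f) :=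
  have := hS.mono_f
  have : Mono (biprod.lift φ S.f ≫ biprod.snd) := by rwa [biprod.lift_snd]
  mono_of_mono _ biprod.snd

lemma pushoutSeq_shortExact : (pushoutSeq S φ).ShortExact := by
  have := mono_biprod_lift hS φ
  have := hS.mono_f
  have := hS.epi_g
  have hcond : φ ≫ biprod.inl ≫ cokernel.π (biprod.lift φ S.f) +
      S.f ≫ biprod.inr ≫ cokernel.π (biprod.lift φ S.f) = 0 := by
    rw [← cokernel.condition (biprod.lift φ S.f)]
    rw [← Category.assoc, ← Category.assoc, ← Preadditive.add_comp]
    congr 1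
    ext <;> simp
  have hmono : Mono (pushoutSeq S φ).f := by
    refine ⟨fun {Z} k k' hk ↦ ?_⟩
    rw [← sub_eq_zero]
    have h₁ : ((k - k') ≫ biprod.inl) ≫ cokernel.π (biprod.lift φ S.f) = 0 := by
      rw [Category.assoc, Preadditive.sub_comp]
      exact sub_eq_zero.2 hk
    obtain ⟨w, hw⟩ : ∃ w, w ≫ biprod.lift φ S.f = (k - k') ≫ biprod.inl :=
      ⟨_, Abelian.monoLift_comp (biprod.lift φ S.f) _ h₁⟩
    have h₂ := congrArg (· ≫ biprod.snd) hw
    simp only [Category.assoc, biprod.lift_snd, biprod.inl_snd, comp_zero] at h₂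
    have h₃ : w = 0 := (cancel_mono S.f).1 (h₂.trans zero_comp.symm)
    have h₄ := congrArg (· ≫ biprod.fst) hw
    simpa [h₃] using h₄.symm
  have hepi : Epi (pushoutSeq S φ).g := by
    have : Epi ((biprod.inr ≫ cokernel.π (biprod.lift φ S.f)) ≫ (pushoutSeq S φ).g) := by
      simpa
    exact epi_of_epi (biprod.inr ≫ cokernel.π (biprod.lift φ S.f)) _
  refine { exact := ?_, mono_f := hmono, epi_g := hepi }
  refine ShortComplex.exact_of_g_is_cokernel _ (CokernelCofork.IsColimit.ofπ' _ _ fun {Z} k hk ↦ ?_)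
  have h₁ : biprod.inl ≫ cokernel.π (biprod.lift φ S.f) ≫ k = 0 :=
    (Category.assoc _ _ _).symm.trans hk
  have h₂ : S.f ≫ biprod.inr ≫ cokernel.π (biprod.lift φ S.f) ≫ k = 0 := by
    have := congrArg (· ≫ k) hcond
    simpa [h₁] using this
  refine ⟨hS.exact.desc _ h₂, ?_⟩
  rw [← cancel_epi (cokernel.π (biprod.lift φ S.f))]
  apply biprod.hom_ext'
  · simp [h₁]
  · simp

/-- The extension class of a pushout. -/
lemma pushoutSeq_extClass [HasExt C] : (pushoutSeq_shortExact hS φ).extClass =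
    hS.extClass.comp (Ext.mk₀ (-φ)) (add_zero 1) := by
  let f : S ⟶ pushoutSeq S φ :=
    { τ₁ := -φ
      τ₂ := biprod.inr ≫ cokernel.π (biprod.lift φ S.f)
      τ₃ := 𝟙 _
      comm₁₂ := by
        have h : S.f ≫ biprod.inr = biprod.lift φ S.f + (-φ) ≫ biprod.inl := by
          ext <;> simp
        dsimp
        rw [← Category.assoc, ← Category.assoc, h, Preadditive.add_comp,
          cokernel.condition, zero_add]
      comm₂₃ := by simp }
  have := ShortComplex.ShortExact.extClass_naturality hS (pushoutSeq_shortExact hS φ) f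
  rw [this]
  exact (Ext.mk₀_id_comp _).symm

end Pushout

variable [HasExt C]


/-- Extension classes are effaceable: the middle term of the triangle on `x : X ⟶ Y⟦1⟧` is
concentrated in degree zero, hence is an object of `C` containing `Y`. -/
lemma exists_mono_comp_eq_zero (x : Ext X Y 1) :
    ∃ (E : C) (f : Y ⟶ E), Mono f ∧ x.comp (Ext.mk₀ f) (add_zero 1) = 0 := by
  let := HasDerivedCategory.standard C
  let F := DerivedCategory.singleFunctor C 0
  let t := DerivedCategory.TStructure.t (C := C)
  obtain ⟨E, f, g, hT⟩ := distinguished_cocone_triangle₂ (C := DerivedCategory C)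
    (Z := F.obj X) (X := F.obj Y) x.hom
  have : DerivedCategory.IsGE E 0 := t.isGE₂ _ hT 0
    (inferInstanceAs (DerivedCategory.IsGE (F.obj Y) 0))
    (inferInstanceAs (DerivedCategory.IsGE (F.obj X) 0))
  have : DerivedCategory.IsLE E 0 := t.isLE₂ _ hT 0
    (inferInstanceAs (DerivedCategory.IsLE (F.obj Y) 0))
    (inferInstanceAs (DerivedCategory.IsLE (F.obj X) 0))
  obtain ⟨E', ⟨e⟩⟩ := E.exists_iso_singleFunctor_obj_of_isGE_of_isLE 0
  obtain ⟨f', hf'⟩ : ∃ f', F.map f' = f ≫ e.hom := F.map_surjective _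
  refine ⟨E', f', ⟨fun {Z} k k' hk ↦ ?_⟩, ?_⟩
  · rw [← sub_eq_zero]
    have hk₁ : F.map (k - k') ≫ f = 0 := by
      rw [← cancel_mono e.hom, Category.assoc, ← hf', ← F.map_comp, Preadditive.sub_comp, hk,
        sub_self, F.map_zero, zero_comp]
    obtain ⟨l, hl⟩ := Triangle.coyoneda_exact₂ _ (inv_rot_of_distTriang _ hT) _ hk₁
    have hl₀ : l = 0 := by
      have h₁ : DerivedCategory.IsLE (F.obj Z) 0 := inferInstance
      have h₂ : DerivedCategory.IsGE (F.obj X) 0 := inferInstance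
      have h₃ : DerivedCategory.IsGE ((F.obj X)⟦(-1 : ℤ)⟧) 1 := t.isGE_shift _ 0 (-1) 1
      exact t.zero_of_isLE_of_isGE l 0 1 (by lia) h₁ h₃
    rw [hl₀, zero_comp] at hl
    exact F.map_injective (hl.trans (F.map_zero _ _).symm)
  · ext
    rw [Ext.comp_hom, Ext.mk₀_hom, ShiftedHom.comp_mk₀, Ext.zero_hom]
    change x.hom ≫ (F.map f')⟦_⟧' = 0
    rw [hf', Functor.map_comp]
    have : x.hom ≫ f⟦(1 : ℤ)⟧' = 0 := comp_distTriang_mor_zero₃₁ _ hT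
    exact (Category.assoc _ _ _).symm.trans ((congrArg (· ≫ _) this).trans zero_comp)

/-- `Ext¹(X, Y)` vanishes if morphisms from `X` lift along epimorphisms with kernel `Y`. -/
lemma ext_one_eq_zero
    (H : ∀ (E Q : C) (i : Y ⟶ E) (p : E ⟶ Q) (w : i ≫ p = 0),
      (ShortComplex.mk i p w).ShortExact → ∀ f : X ⟶ Q, ∃ f', f' ≫ p = f)
    (x : Ext X Y 1) : x = 0 := by
  obtain ⟨E, i, hi, hx⟩ := exists_mono_comp_eq_zero x
  have hS : (ShortComplex.mk i (cokernel.π i) (cokernel.condition i)).ShortExact :=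
    { exact := ShortComplex.exact_cokernel i }
  obtain ⟨f, rfl⟩ := Ext.covariant_sequence_exact₁ X hS x hx (zero_add 1)
  obtain ⟨f, rfl⟩ := (Ext.mk₀_bijective _ _).2 f
  obtain ⟨f', rfl⟩ := H _ _ _ _ _ hS f
  dsimp only
  rw [← Ext.mk₀_comp_mk₀, Ext.comp_assoc_of_second_deg_zero]
  exact (congrArg (fun y ↦ (Ext.mk₀ f').comp y (zero_add 1)) hS.comp_extClass).trans
    (Ext.comp_zero _ _ _ _ _)

section Middle

variable {E F : C} {i : Y ⟶ E} {p : E ⟶ X} {w : i ≫ p = 0}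
  (h : (ShortComplex.mk i p w).ShortExact)

include h in
lemma nonempty_iso_biprod_of_extClass_eq_zero (h₀ : h.extClass = 0) :
    Nonempty (E ≅ Y ⊞ X) := by
  obtain ⟨s, hs⟩ := Ext.covariant_sequence_exact₃ X h (Ext.mk₀ (𝟙 X)) (zero_add 1)
    (by rw [h₀]; exact Ext.comp_zero _ _ _ _ _)
  obtain ⟨s, rfl⟩ := (Ext.mk₀_bijective _ _).2 s
  rw [Ext.mk₀_comp_mk₀] at hs
  have hs' : s ≫ p = 𝟙 X := (Ext.mk₀_bijective _ _).1 hs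
  have := h.mono_f
  exact ⟨(ShortComplex.Splitting.ofExactOfSection _ h.exact s hs' this).isoBinaryBiproduct⟩

/-- If the pullback of a nonzero extension of `X` by `Y` along an epimorphism `F ⟶ X` with kernel
`Y` splits, then `F` is isomorphic to the middle term of the extension, provided that all
endomorphisms of `Y` are scalars. -/
lemma nonempty_iso_of_comp_extClass_eq_zero {k : Type*} [Field k] [Linear k C]
    (hY : ∀ f : Y ⟶ Y, ∃ c : k, f = c • 𝟙 Y) (h₀ : h.extClass ≠ 0)
    {j : Y ⟶ F} {q : F ⟶ X} {w' : j ≫ q = 0} (hT : (ShortComplex.mk j q w').ShortExact)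
    (hq : (Ext.mk₀ q).comp h.extClass (zero_add 1) = 0) : Nonempty (E ≅ F) := by
  obtain ⟨u, hu⟩ := Ext.covariant_sequence_exact₃ F h (Ext.mk₀ q) (zero_add 1) hq
  obtain ⟨u, rfl⟩ := (Ext.mk₀_bijective _ _).2 u
  rw [Ext.mk₀_comp_mk₀] at hu
  have hu' : u ≫ p = q := (Ext.mk₀_bijective _ _).1 hu
  have := h.mono_f
  let s : Y ⟶ Y := h.exact.lift (j ≫ u) (by simp [hu', w'])
  have hs : s ≫ i = j ≫ u := h.exact.lift_f _ _
  obtain ⟨c, hc⟩ := hY s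
  let f : ShortComplex.mk j q w' ⟶ ShortComplex.mk i p w :=
    { τ₁ := s, τ₂ := u, τ₃ := 𝟙 _, comm₁₂ := hs, comm₂₃ := by simp [hu'] }
  have hf : hT.extClass.comp (Ext.mk₀ s) (add_zero 1) = h.extClass :=
    (ShortComplex.ShortExact.extClass_naturality hT h f).trans (Ext.mk₀_id_comp _)
  have hc₀ : c ≠ 0 := by
    rintro rfl
    rw [hc, zero_smul, Ext.mk₀_zero, Ext.comp_zero] at hf
    exact h₀ hf.symm
  have : IsIso f.τ₁ := by
    change IsIso s
    rw [hc]
    exact ⟨c⁻¹ • 𝟙 Y, by simp [smul_smul, hc₀], by simp [smul_smul, hc₀]⟩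
  have : IsIso f.τ₃ := inferInstanceAs (IsIso (𝟙 X))
  have : IsIso f.τ₂ := ShortComplex.isIso₂_of_shortExact_of_isIso₁₃ f hT h
  exact ⟨(asIso f.τ₂).symm⟩

end Middle

end Abelian

/-- The vanishing of `Ext¹(𝒪(-1), 𝒪(-2))`, which is `H¹(𝒪(-1))`. -/
lemma ext_one_neg_one_neg_two_eq_zero (x : Abelian.Ext (O (-1)) (O (-2)) 1) : x = 0 :=
  ext_one_eq_zero (fun _ _ _ _ _ hS f ↦ exists_lift hS f) x

end

/-! ### Coordinates, Koszul complexes and the relations between the cubic monomials -/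

section

/-- Coordinates over an open set `V` on which `x` or `y` is invertible: the line bundles `𝒪(n)` are
compatibly trivialised over `V`, and multiplication by `x` and by `y` becomes multiplication by the
functions `ξ` and `η`, one of which is `1`. -/
structure Chart (V : P1.Opens) where
  ξ : Γ(P1, V)
  η : Γ(P1, V)
  eq_one : ξ = 1 ∨ η = 1
  coord (n : ℤ) : Γ(O n, V) ≃+ Γ(P1, V)
  coord_smul (n : ℤ) (r : Γ(P1, V)) (s : Γ(O n, V)) : coord n (r • s) = r * coord n s
  coord_mulMonomial (i j : ℕ) {m n : ℤ} (h : n = m + i + j) (s : Γ(O m, V)) :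
    coord n ((mulMonomial i j h).app V s) = ξ ^ i * η ^ j * coord m s

lemma nonempty_chart {V : P1.Opens} (hV : V ≤ D 0 ∨ V ≤ D 1) : Nonempty (Chart V) := by
  obtain h | h := hV
  · let c (n : ℤ) (s : glueSections (D 0) (D 1) (ratio ^ n) V) : Γ(P1, V) :=
      res (le_inf le_rfl h) s.1.1
    have c_smul (n : ℤ) (r : Γ(P1, V)) (s : Γ(O n, V)) : c n (r • s) = r * c n s :=
      (map_mul _ _ _).trans (congrArg (· * _) ((res_res _ _ _).trans (res_self _ _)))
    have c_e (n : ℤ) : c n (secRes (O n) h (e₀ n)) = 1 :=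
      (congrArg _ (map_one (res _))).trans (map_one _)
    exact ⟨{
      ξ := 1
      η := res h (coordQuot 0 1)
      eq_one := .inl rfl
      coord n :=
        { toFun := c n
          invFun r := r • secRes (O n) h (e₀ n)
          left_inv s := (secRes_eq_smul_gen₀ (U₀ := D 0) (U₁ := D 1) (g := ratio ^ n) le_rfl h
            s).symm.trans (secRes_self _ _)
          right_inv r := (c_smul _ _ _).trans (by rw [c_e, mul_one])
          map_add' s t := map_add (res _) _ _ }
      coord_smul := c_smul
      coord_mulMonomial i j {m n} h' s := by
        change res _ (res _ (coordQuot 0 1 ^ j) * _) = 1 ^ i * res h (coordQuot 0 1) ^ j * res _ _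
        rw [map_mul, res_res, map_pow, one_pow, one_mul] }⟩
  · let c (n : ℤ) (s : glueSections (D 0) (D 1) (ratio ^ n) V) : Γ(P1, V) :=
      res (le_inf le_rfl h) s.1.2
    have c_smul (n : ℤ) (r : Γ(P1, V)) (s : Γ(O n, V)) : c n (r • s) = r * c n s :=
      (map_mul _ _ _).trans (congrArg (· * _) ((res_res _ _ _).trans (res_self _ _)))
    have c_e (n : ℤ) : c n (secRes (O n) h (e₁ n)) = 1 :=
      (congrArg _ (map_one (res _))).trans (map_one _)
    exact ⟨{
      ξ := res h (coordQuot 1 0)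
      η := 1
      eq_one := .inr rfl
      coord n :=
        { toFun := c n
          invFun r := r • secRes (O n) h (e₁ n)
          left_inv s := (secRes_eq_smul_gen₁ (U₀ := D 0) (U₁ := D 1) (g := ratio ^ n) le_rfl h
            s).symm.trans (secRes_self _ _)
          right_inv r := (c_smul _ _ _).trans (by rw [c_e, mul_one])
          map_add' s t := map_add (res _) _ _ }
      coord_smul := c_smul
      coord_mulMonomial i j {m n} h' s := by
        change res _ (res _ (coordQuot 1 0 ^ i) * _) = res h (coordQuot 1 0) ^ i * 1 ^ j * res _ _
        rw [map_mul, res_res, map_pow, one_pow, mul_one] }⟩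

lemma Chart.coord_hom_smul {V : P1.Opens} (τ : Chart V) {m n : ℤ} (c : ℂ) (f : O m ⟶ O n)
    (s : Γ(O m, V)) : τ.coord n ((c • f).app V s) = const V c * τ.coord n (f.app V s) :=
  τ.coord_smul _ _ _

section Biproducts

variable {X : Scheme.{0}} {A B M : X.Modules} {V : X.Opens}

lemma biprod_sec_ext {s t : Γ(A ⊞ B, V)}
    (h₁ : (biprod.fst : A ⊞ B ⟶ A).app V s = (biprod.fst : A ⊞ B ⟶ A).app V t)
    (h₂ : (biprod.snd : A ⊞ B ⟶ B).app V s = (biprod.snd : A ⊞ B ⟶ B).app V t) : s = t := by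
  have e (s : Γ(A ⊞ B, V)) : s = (biprod.inl : A ⟶ A ⊞ B).app V ((biprod.fst : A ⊞ B ⟶ A).app V s) +
      (biprod.inr : B ⟶ A ⊞ B).app V ((biprod.snd : A ⊞ B ⟶ B).app V s) := by
    rw [← comp_app_apply, ← comp_app_apply, ← add_app_apply, biprod.total, id_app_apply]
  rw [e s, e t, h₁, h₂]

lemma exists_biprod_sec (s : Γ(A, V)) (t : Γ(B, V)) : ∃ r : Γ(A ⊞ B, V),
    (biprod.fst : A ⊞ B ⟶ A).app V r = s ∧ (biprod.snd : A ⊞ B ⟶ B).app V r = t := by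
  refine ⟨(biprod.inl : A ⟶ A ⊞ B).app V s + (biprod.inr : B ⟶ A ⊞ B).app V t, ?_, ?_⟩
  · rw [map_add, ← comp_app_apply, ← comp_app_apply, biprod.inl_fst, biprod.inr_fst, id_app_apply,
      zero_app_apply, add_zero]
  · rw [map_add, ← comp_app_apply, ← comp_app_apply, biprod.inl_snd, biprod.inr_snd, id_app_apply,
      zero_app_apply, zero_add]

lemma biprod_desc_app (f : A ⟶ M) (g : B ⟶ M) (s : Γ(A ⊞ B, V)) :
    (biprod.desc f g).app V s = f.app V ((biprod.fst : A ⊞ B ⟶ A).app V s) +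
      g.app V ((biprod.snd : A ⊞ B ⟶ B).app V s) := by
  rw [biprod.desc_eq, add_app_apply, comp_app_apply, comp_app_apply]

variable {n : ℕ} {F : Fin n → P1.Modules} {V : P1.Opens}

lemma biproduct_sec_ext {s t : Γ(⨁ F, V)}
    (h : ∀ j, (biproduct.π F j).app V s = (biproduct.π F j).app V t) : s = t := by
  have e (s : Γ(⨁ F, V)) : s = ∑ j, (biproduct.ι F j).app V ((biproduct.π F j).app V s) := by
    simp only [← comp_app_apply]
    rw [← sum_app_apply, biproduct.total, id_app_apply]
  rw [e s, e t]
  simp only [h]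

lemma exists_biproduct_sec (s : ∀ j, Γ(F j, V)) :
    ∃ t : Γ(⨁ F, V), ∀ j, (biproduct.π F j).app V t = s j := by
  refine ⟨∑ j, (biproduct.ι F j).app V (s j), fun j ↦ ?_⟩
  rw [map_sum, Finset.sum_eq_single j]
  · rw [← comp_app_apply, biproduct.ι_π_self, id_app_apply]
  · intro k _ hk
    rw [← comp_app_apply, biproduct.ι_π_ne _ hk, zero_app_apply]
  · simp

lemma biproduct_desc_app {M : P1.Modules} (f : ∀ j, F j ⟶ M) (s : Γ(⨁ F, V)) :
    (biproduct.desc f).app V s = ∑ j, (f j).app V ((biproduct.π F j).app V s) := by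
  rw [biproduct.desc_eq, sum_app_apply]
  rfl

end Biproducts

/-- The Koszul complex of two forms `p`, `q` without common zeros is exact. -/
lemma koszul_shortExact {a b c d : ℤ} {P : O a ⟶ O b} {Q : O a ⟶ O c} {Q' : O b ⟶ O d}
    {P' : O c ⟶ O d} {w : biprod.lift P Q ≫ biprod.desc Q' (-P') = 0}
    (H : ∀ (V : P1.Opens) (τ : Chart V), ∃ p q α β : Γ(P1, V), α * p + β * q = 1 ∧
      (∀ s, τ.coord b (P.app V s) = p * τ.coord a s) ∧
      (∀ s, τ.coord c (Q.app V s) = q * τ.coord a s) ∧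
      (∀ s, τ.coord d (Q'.app V s) = q * τ.coord b s) ∧
      (∀ s, τ.coord d (P'.app V s) = p * τ.coord c s)) :
    (ShortComplex.mk (biprod.lift P Q) (biprod.desc Q' (-P')) w).ShortExact := by
  have hl {V : P1.Opens} (s : Γ(O a, V)) :
      (biprod.fst : O b ⊞ O c ⟶ _).app V ((biprod.lift P Q).app V s) = P.app V s := by
    rw [← comp_app_apply, biprod.lift_fst]
  have hr {V : P1.Opens} (s : Γ(O a, V)) :
      (biprod.snd : O b ⊞ O c ⟶ _).app V ((biprod.lift P Q).app V s) = Q.app V s := by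
    rw [← comp_app_apply, biprod.lift_snd]
  refine shortExact_of_sections D_sup (fun V hV s hs ↦ ?_) (fun V hV s hs ↦ ?_) (fun V hV s ↦ ?_)
  all_goals
    obtain ⟨τ⟩ := nonempty_chart hV
    obtain ⟨p, q, α, β, h, hP, hQ, hQ', hP'⟩ := H V τ
    dsimp only at s ⊢
  · dsimp only at hs
    have h₁ := hl s
    have h₂ := hr s
    rw [hs, map_zero] at h₁ h₂
    apply (τ.coord a).injective
    have e₁ := hP s
    have e₂ := hQ s
    rw [← h₁, map_zero] at e₁
    rw [← h₂, map_zero] at e₂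
    rw [map_zero]
    linear_combination (-τ.coord a s) * h - α * e₁ - β * e₂
  · dsimp only at hs
    rw [biprod_desc_app, neg_app_apply] at hs
    have e := congrArg (τ.coord d) hs
    rw [map_add, map_neg, map_zero, hQ', hP'] at e
    obtain ⟨t, ht⟩ := (τ.coord a).surjective
      (α * τ.coord b ((biprod.fst : O b ⊞ O c ⟶ _).app V s) +
        β * τ.coord c ((biprod.snd : O b ⊞ O c ⟶ _).app V s))
    refine ⟨t, biprod_sec_ext ((hl t).trans ((τ.coord b).injective ?_))
      ((hr t).trans ((τ.coord c).injective ?_))⟩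
    · rw [hP, ht]
      linear_combination (τ.coord b ((biprod.fst : O b ⊞ O c ⟶ _).app V s)) * h - β * e
    · rw [hQ, ht]
      linear_combination (τ.coord c ((biprod.snd : O b ⊞ O c ⟶ _).app V s)) * h + α * e
  · obtain ⟨y, hy⟩ := (τ.coord b).surjective (β * τ.coord d s)
    obtain ⟨z, hz⟩ := (τ.coord c).surjective (-α * τ.coord d s)
    obtain ⟨t, rfl, rfl⟩ := exists_biprod_sec y z
    refine ⟨t, (τ.coord d).injective ?_⟩
    rw [biprod_desc_app, neg_app_apply, map_add, map_neg, hQ', hP', hy, hz]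
    linear_combination τ.coord d s * h

/-- The map `𝒪(-2)^3 ⟶ 𝒪(-1)^4` with matrix rows `(x, 0, 0), (y, x, 0), (0, y, x), (0, 0, y)`. -/
def syzygy : (⨁ fun _ : Fin 3 ↦ O (-2)) ⟶ ⨁ fun _ : Fin 4 ↦ O (-1) :=
  biproduct.matrix fun j i ↦
      (!![mulMonomial 1 0 (by norm_num), 0, 0;
          mulMonomial 0 1 (by norm_num), mulMonomial 1 0 (by norm_num), 0;
          0, mulMonomial 0 1 (by norm_num), mulMonomial 1 0 (by norm_num);
          0, 0, mulMonomial 0 1 (by norm_num)] : Matrix (Fin 4) (Fin 3) (O (-2) ⟶ O (-1))) i j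

/-- The map `𝒪(-2)^3 ⟶ 𝒪(-2)` with matrix `(v₀, v₁, v₂)`. -/
def scalarRow (v : Fin 3 → ℂ) : (⨁ fun _ : Fin 3 ↦ O (-2)) ⟶ O (-2) :=
  biproduct.desc fun i ↦ v i • 𝟙 (O (-2))

lemma desc_eq_scalarRow (a b c : ℂ) :
    biproduct.desc ![a • 𝟙 (O (-2)), b • 𝟙 (O (-2)), c • 𝟙 (O (-2))] = scalarRow ![a, b, c] := by
  refine biproduct.hom_ext' _ _ fun i ↦ ?_
  rw [scalarRow, biproduct.ι_desc, biproduct.ι_desc]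
  fin_cases i <;> rfl

lemma presentation_eq (a b c : ℂ) :
    presentation a b c = biprod.lift (scalarRow ![a, b, c]) syzygy :=
  congrArg (biprod.lift · syzygy) (desc_eq_scalarRow a b c)

lemma syzygy_quotForm : syzygy ≫ quotForm = 0 := by
  have h' := presentation_comp 0 0 0
  rw [presentation_eq, biprod.lift_desc, comp_zero, zero_add] at h'
  exact h'

/-- The cubic monomials, up to sign, as a map onto `𝒪(2)`, and the relations between them. -/
abbrev cubicSeq : ShortComplex P1.Modules := ShortComplex.mk syzygy quotForm syzygy_quotForm

lemma cubicSeq_shortExact : cubicSeq.ShortExact := by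
  have hs {V : P1.Opens} (τ : Chart V) (s : Γ(⨁ fun _ : Fin 3 ↦ O (-2), V)) (j : Fin 4) :
      τ.coord (-1) ((biproduct.π (fun _ : Fin 4 ↦ O (-1)) j).app V (syzygy.app V s)) =
        (![![τ.ξ, 0, 0], ![τ.η, τ.ξ, 0], ![0, τ.η, τ.ξ], ![0, 0, τ.η]] j) 0 *
          τ.coord (-2) ((biproduct.π (fun _ : Fin 3 ↦ O (-2)) 0).app V s) +
        (![![τ.ξ, 0, 0], ![τ.η, τ.ξ, 0], ![0, τ.η, τ.ξ], ![0, 0, τ.η]] j) 1 *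
          τ.coord (-2) ((biproduct.π (fun _ : Fin 3 ↦ O (-2)) 1).app V s) +
        (![![τ.ξ, 0, 0], ![τ.η, τ.ξ, 0], ![0, τ.η, τ.ξ], ![0, 0, τ.η]] j) 2 *
          τ.coord (-2) ((biproduct.π (fun _ : Fin 3 ↦ O (-2)) 2).app V s) := by
    rw [← comp_app_apply, syzygy, biproduct.matrix_π, biproduct_desc_app, Fin.sum_univ_three,
      map_add, map_add]
    fin_cases j <;> simp [τ.coord_mulMonomial]
  have hq {V : P1.Opens} (τ : Chart V) (s : Γ(⨁ fun _ : Fin 4 ↦ O (-1), V)) :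
      τ.coord 2 (quotForm.app V s) =
        τ.η ^ 3 * τ.coord (-1) ((biproduct.π (fun _ : Fin 4 ↦ O (-1)) 0).app V s) -
        τ.ξ * τ.η ^ 2 * τ.coord (-1) ((biproduct.π (fun _ : Fin 4 ↦ O (-1)) 1).app V s) +
        τ.ξ ^ 2 * τ.η * τ.coord (-1) ((biproduct.π (fun _ : Fin 4 ↦ O (-1)) 2).app V s) -
        τ.ξ ^ 3 * τ.coord (-1) ((biproduct.π (fun _ : Fin 4 ↦ O (-1)) 3).app V s) := by
    rw [quotForm, biproduct_desc_app, Fin.sum_univ_four]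
    simp [τ.coord_mulMonomial, neg_app_apply]
    ring
  refine shortExact_of_sections D_sup (fun V hV s h ↦ ?_) (fun V hV s h ↦ ?_) (fun V hV s ↦ ?_)
  all_goals
    obtain ⟨τ⟩ := nonempty_chart hV
    dsimp only at s ⊢
  · dsimp only at h
    have e := hs τ s
    rw [h] at e
    have e₀ := e 0
    have e₁ := e 1
    have e₂ := e 2
    have e₃ := e 3
    simp at e₀ e₁ e₂ e₃
    refine biproduct_sec_ext fun j ↦ (τ.coord (-2)).injective ?_
    rw [map_zero, map_zero]
    obtain h₁ | h₁ := τ.eq_one <;> simp only [h₁, one_mul] at e₀ e₁ e₂ e₃ <;>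
      fin_cases j <;> dsimp only [Fin.zero_eta, Fin.mk_one, Fin.reduceFinMk]
    · exact e₀.symm
    · linear_combination -e₁ + τ.η * e₀
    · linear_combination -e₂ + τ.η * e₁ - τ.η ^ 2 * e₀
    · linear_combination -e₁ + τ.ξ * e₂ - τ.ξ ^ 2 * e₃
    · linear_combination -e₂ + τ.ξ * e₃
    · exact e₃.symm
  · dsimp only at h
    have e := hq τ s
    rw [h, map_zero] at e
    set x₀ := τ.coord (-1) ((biproduct.π (fun _ : Fin 4 ↦ O (-1)) 0).app V s)
    set x₁ := τ.coord (-1) ((biproduct.π (fun _ : Fin 4 ↦ O (-1)) 1).app V s)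
    set x₂ := τ.coord (-1) ((biproduct.π (fun _ : Fin 4 ↦ O (-1)) 2).app V s)
    set x₃ := τ.coord (-1) ((biproduct.π (fun _ : Fin 4 ↦ O (-1)) 3).app V s)
    obtain ⟨y, h₀, h₁, h₂, h₃⟩ : ∃ y : Fin 3 → Γ(P1, V), τ.ξ * y 0 = x₀ ∧
        τ.η * y 0 + τ.ξ * y 1 = x₁ ∧ τ.η * y 1 + τ.ξ * y 2 = x₂ ∧ τ.η * y 2 = x₃ := by
      obtain h₁ | h₁ := τ.eq_one <;> rw [h₁] at e ⊢
      · refine ⟨![x₀, x₁ - τ.η * x₀, x₂ - τ.η * (x₁ - τ.η * x₀)], ?_, ?_, ?_, ?_⟩ <;>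
          simp only [Matrix.cons_val]
        · ring
        · ring
        · ring
        · linear_combination -e
      · refine ⟨![x₁ - τ.ξ * (x₂ - τ.ξ * x₃), x₂ - τ.ξ * x₃, x₃], ?_, ?_, ?_, ?_⟩ <;>
          simp only [Matrix.cons_val]
        · linear_combination e
        · ring
        · ring
        · ring
    obtain ⟨t, ht⟩ := exists_biproduct_sec (F := fun _ : Fin 3 ↦ O (-2))
      fun j ↦ (τ.coord (-2)).symm (y j)
    refine ⟨t, biproduct_sec_ext fun j ↦ (τ.coord (-1)).injective ?_⟩
    rw [hs, ht, ht, ht, AddEquiv.apply_symm_apply, AddEquiv.apply_symm_apply,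
      AddEquiv.apply_symm_apply]
    fin_cases j <;> simp
    exacts [h₀, h₁, h₂, h₃]
  · obtain ⟨y₀, y₃, hy⟩ : ∃ y₀ y₃, τ.η ^ 3 * y₀ - τ.ξ ^ 3 * y₃ = τ.coord 2 s := by
      obtain h₁ | h₁ := τ.eq_one <;> rw [h₁]
      · exact ⟨0, -τ.coord 2 s, by ring⟩
      · exact ⟨τ.coord 2 s, 0, by ring⟩
    obtain ⟨t, ht⟩ := exists_biproduct_sec (F := fun _ : Fin 4 ↦ O (-1))
      fun j ↦ (τ.coord (-1)).symm (![y₀, 0, 0, y₃] j)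
    refine ⟨t, (τ.coord 2).injective ?_⟩
    rw [hq, ht, ht, ht, ht, ← hy]
    simp only [AddEquiv.apply_symm_apply, Matrix.cons_val]
    ring

end

/-! ### Forms as morphisms of line bundles -/

section

open Abelian

section Forms

/-- Morphisms between line bundles that agree in coordinates are equal. -/
lemma hom_ext_chart {m n : ℤ} {f g : O m ⟶ O n}
    (h : ∀ (V : P1.Opens) (τ : Chart V) (s : Γ(O m, V)),
      τ.coord n (f.app V s) = τ.coord n (g.app V s)) : f = g := by
  obtain ⟨τ₀⟩ := nonempty_chart (V := D 0) (.inl le_rfl)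
  obtain ⟨τ₁⟩ := nonempty_chart (V := D 1) (.inr le_rfl)
  exact glue_hom_ext D_sup ((τ₀.coord n).injective (h _ τ₀ _)) ((τ₁.coord n).injective (h _ τ₁ _))

/-- Multiplication by the linear form `α x + β y`. -/
def linearForm (α β : ℂ) {m n : ℤ} (h : n = m + 1) : O m ⟶ O n :=
  α • mulMonomial 1 0 (by simp [h]) + β • mulMonomial 0 1 (by simp [h])

/-- Multiplication by the quadratic form `α x ^ 2 + β x y + γ y ^ 2`. -/
def quadraticForm (α β γ : ℂ) {m n : ℤ} (h : n = m + 2) : O m ⟶ O n :=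
  α • mulMonomial 2 0 (by simp [h]) + β • mulMonomial 1 1 (by simp [h]; ring) +
    γ • mulMonomial 0 2 (by simp [h])

variable {V : P1.Opens} (τ : Chart V) {m n : ℤ}

lemma Chart.coord_linearForm (α β : ℂ) (h : n = m + 1) (s : Γ(O m, V)) :
    τ.coord n ((linearForm α β h).app V s) =
      (const V α * τ.ξ + const V β * τ.η) * τ.coord m s := by
  simp only [linearForm, add_app_apply, map_add, τ.coord_hom_smul, τ.coord_mulMonomial]
  ring

lemma Chart.coord_quadraticForm (α β γ : ℂ) (h : n = m + 2) (s : Γ(O m, V)) :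
    τ.coord n ((quadraticForm α β γ h).app V s) =
      (const V α * τ.ξ ^ 2 + const V β * (τ.ξ * τ.η) + const V γ * τ.η ^ 2) * τ.coord m s := by
  simp only [quadraticForm, add_app_apply, map_add, τ.coord_hom_smul, τ.coord_mulMonomial]
  ring

end Forms

lemma koszul_comp {a b c d : ℤ} {P : O a ⟶ O b} {Q : O a ⟶ O c} {Q' : O b ⟶ O d} {P' : O c ⟶ O d}
    (H : ∀ (V : P1.Opens) (τ : Chart V), ∃ p q : Γ(P1, V),
      (∀ s, τ.coord b (P.app V s) = p * τ.coord a s) ∧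
      (∀ s, τ.coord c (Q.app V s) = q * τ.coord a s) ∧
      (∀ s, τ.coord d (Q'.app V s) = q * τ.coord b s) ∧
      (∀ s, τ.coord d (P'.app V s) = p * τ.coord c s)) :
    biprod.lift P Q ≫ biprod.desc Q' (-P') = 0 := by
  rw [biprod.lift_desc, Preadditive.comp_neg, ← sub_eq_add_neg, sub_eq_zero]
  refine hom_ext_chart fun V τ s ↦ ?_
  obtain ⟨p, q, hP, hQ, hQ', hP'⟩ := H V τ
  rw [comp_app_apply, comp_app_apply, hQ', hP', hP, hQ]
  ring

/-- The Koszul complex `𝒪(m) ⟶ 𝒪(m + 1) ⊕ 𝒪(m + 1) ⟶ 𝒪(m + 2)` of `x` and `y`. -/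
abbrev eulerSeq {m n d : ℤ} (h : n = m + 1) (h' : d = n + 1) : ShortComplex P1.Modules :=
  ShortComplex.mk (biprod.lift (linearForm 1 0 h) (linearForm 0 1 h))
    (biprod.desc (linearForm 0 1 h') (-linearForm 1 0 h')) (koszul_comp fun V τ ↦
      ⟨τ.ξ, τ.η, fun s ↦ by simp [τ.coord_linearForm], fun s ↦ by simp [τ.coord_linearForm],
        fun s ↦ by simp [τ.coord_linearForm], fun s ↦ by simp [τ.coord_linearForm]⟩)

lemma eulerSeq_shortExact {m n d : ℤ} (h : n = m + 1) (h' : d = n + 1) :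
    (eulerSeq h h').ShortExact := by
  refine koszul_shortExact fun V τ ↦ ?_
  obtain ⟨α, β, e⟩ : ∃ α β, α * τ.ξ + β * τ.η = 1 := by
    obtain h₁ | h₁ := τ.eq_one
    · exact ⟨1, 0, by simp [h₁]⟩
    · exact ⟨0, 1, by simp [h₁]⟩
  exact ⟨τ.ξ, τ.η, α, β, e, fun s ↦ by simp [τ.coord_linearForm],
    fun s ↦ by simp [τ.coord_linearForm], fun s ↦ by simp [τ.coord_linearForm],
    fun s ↦ by simp [τ.coord_linearForm]⟩

/-! ### The extension classes -/

section ExtClass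

lemma scalarRow_add (v w : Fin 3 → ℂ) : scalarRow (v + w) = scalarRow v + scalarRow w := by
  refine biproduct.hom_ext' _ _ fun i ↦ ?_
  simp [scalarRow, add_smul]

lemma scalarRow_smul (c : ℂ) (v : Fin 3 → ℂ) : scalarRow (c • v) = c • scalarRow v := by
  refine biproduct.hom_ext' _ _ fun i ↦ ?_
  simp [scalarRow, mul_smul]

/-- The linear map from `ℂ³` to `Ext¹(𝒪(2), 𝒪(-2))` that sends `v` to the class of the pushout of
`cubicSeq` along `scalarRow v`. -/
def classMap : (Fin 3 → ℂ) →ₗ[ℂ] Ext (O 2) (O (-2)) 1 where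
  toFun v := cubicSeq_shortExact.extClass.comp (Ext.mk₀ (-scalarRow v)) (add_zero 1)
  map_add' v w := by
    rw [scalarRow_add, neg_add, Ext.mk₀_add, Ext.comp_add]
  map_smul' c v := by
    rw [scalarRow_smul, ← smul_neg, Ext.mk₀_smul, Ext.comp_smul]
    rfl

/-- The kernel of the connecting map is the image of `Hom(𝒪(-1)^4, 𝒪(-2)) = 0`. -/
lemma classMap_injective : Function.Injective classMap := by
  rw [injective_iff_map_eq_zero]
  intro v hv
  obtain ⟨g, hg⟩ := Ext.contravariant_sequence_exact₁ cubicSeq_shortExact _ _ (add_zero 1) hv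
  obtain ⟨g, rfl⟩ := (Ext.mk₀_bijective _ _).2 g
  have hg₀ : g = 0 := biproduct.hom_ext' _ _ fun j ↦
    (hom_eq_zero _).trans (hom_eq_zero _).symm
  rw [hg₀, Ext.mk₀_zero, Ext.comp_zero] at hg
  have h : scalarRow v = 0 := neg_eq_zero.1 ((Ext.mk₀_eq_zero_iff _).1 hg.symm)
  funext i
  have := congrArg (biproduct.ι _ i ≫ ·) h
  simp only [scalarRow, biproduct.ι_desc, comp_zero] at this
  exact smul_id_eq_zero this

/-- The cokernel of the connecting map embeds into `Ext¹(𝒪(-1)^4, 𝒪(-2)) = 0`. -/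
lemma classMap_surjective : Function.Surjective classMap := by
  intro x
  have h : (Ext.mk₀ quotForm).comp x (zero_add 1) = 0 := by
    refine (Ext.biproductAddEquiv (biproduct.isBilimit fun _ : Fin 4 ↦ O (-1)) _ _).injective ?_
    funext j
    exact (ext_one_neg_one_neg_two_eq_zero _).trans (ext_one_neg_one_neg_two_eq_zero _).symm
  obtain ⟨y, rfl⟩ := Ext.contravariant_sequence_exact₃ cubicSeq_shortExact _ x h (add_zero 1)
  obtain ⟨f, rfl⟩ := (Ext.mk₀_bijective _ _).2 y
  choose c hc using fun i ↦ exists_eq_smul_id (biproduct.ι (fun _ : Fin 3 ↦ O (-2)) i ≫ f)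
  refine ⟨-c, ?_⟩
  have : -scalarRow (-c) = f := by
    refine biproduct.hom_ext' _ _ fun i ↦ ?_
    rw [hc]
    simp [scalarRow]
  rw [← this]
  rfl

/-- The pullback of the extension with class `classMap v` along a quadratic form splits if the
quadratic form is orthogonal to `v`. -/
lemma quadraticForm_comp_classMap {v : Fin 3 → ℂ} {α β γ : ℂ}
    (h : α * v 2 - β * v 1 + γ * v 0 = 0) :
    (Ext.mk₀ (quadraticForm α β γ (m := 0) (n := 2) rfl)).comp (classMap v) (zero_add 1) = 0 := by
  -- the first column of linear forms is `y ^ 2` times the Koszul relation, the second and third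
  -- columns are `-x y` and `x ^ 2` times it
  let t : O (-2) ⟶ ⨁ fun _ : Fin 3 ↦ O (-2) :=
    γ • biproduct.ι (fun _ : Fin 3 ↦ O (-2)) 0 - β • biproduct.ι (fun _ : Fin 3 ↦ O (-2)) 1 +
      α • biproduct.ι (fun _ : Fin 3 ↦ O (-2)) 2
  let f : eulerSeq (m := -2) (n := -1) (d := 0) rfl rfl ⟶ cubicSeq :=
    { τ₁ := t
      τ₂ := biprod.desc
        (γ • biproduct.ι (fun _ : Fin 4 ↦ O (-1)) 0 - β • biproduct.ι (fun _ : Fin 4 ↦ O (-1)) 1 +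
          α • biproduct.ι (fun _ : Fin 4 ↦ O (-1)) 2)
        (γ • biproduct.ι (fun _ : Fin 4 ↦ O (-1)) 1 - β • biproduct.ι (fun _ : Fin 4 ↦ O (-1)) 2 +
          α • biproduct.ι (fun _ : Fin 4 ↦ O (-1)) 3)
      τ₃ := quadraticForm α β γ rfl
      comm₁₂ := by
        refine biproduct.hom_ext _ _ fun j ↦ ?_
        fin_cases j <;> simp [t, syzygy, linearForm] <;> abel
      comm₂₃ := by
        refine biprod.hom_ext' _ _ (hom_ext_chart fun V τ s ↦ ?_) (hom_ext_chart fun V τ s ↦ ?_)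
        all_goals
          simp [quotForm, τ.coord_linearForm, τ.coord_quadraticForm, τ.coord_hom_smul,
            τ.coord_mulMonomial, neg_app_apply]
          ring }
  have hf := ShortComplex.ShortExact.extClass_naturality (eulerSeq_shortExact _ _)
    cubicSeq_shortExact f
  have ht : t ≫ (-scalarRow v) = 0 := by
    have : t ≫ scalarRow v = (α * v 2 - β * v 1 + γ * v 0) • 𝟙 (O (-2)) := by
      simp [t, scalarRow, smul_smul]
      module
    rw [Preadditive.comp_neg, this, h, zero_smul, neg_zero]
  change (Ext.mk₀ f.τ₃).comp (cubicSeq_shortExact.extClass.comp _ (add_zero 1)) _ = 0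
  rw [← Ext.comp_assoc_of_third_deg_zero, ← hf, Ext.comp_assoc_of_third_deg_zero,
    Ext.mk₀_comp_mk₀]
  change Ext.comp _ (Ext.mk₀ (t ≫ (-scalarRow v))) _ = 0
  rw [ht, Ext.mk₀_zero, Ext.comp_zero]

/-- The pullback of the extension along a linear form `l` splits if those along `x l` and `y l`
do. -/
lemma linearForm_comp_classMap {v : Fin 3 → ℂ} {α β : ℂ}
    (h : α * v 2 - β * v 1 = 0) (h' : α * v 1 - β * v 0 = 0) :
    (Ext.mk₀ (linearForm α β (m := 1) (n := 2) rfl)).comp (classMap v) (zero_add 1) = 0 := by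
  have hT := eulerSeq_shortExact (m := -1) (n := 0) (d := 1) rfl rfl
  have hy : linearForm 0 1 (m := 0) (n := 1) rfl ≫ linearForm α β (m := 1) (n := 2) rfl =
      quadraticForm 0 α β rfl := hom_ext_chart fun V τ s ↦ by
    rw [comp_app_apply, τ.coord_linearForm, τ.coord_linearForm, τ.coord_quadraticForm, map_zero,
      map_one]
    ring
  have hx : linearForm 1 0 (m := 0) (n := 1) rfl ≫ linearForm α β (m := 1) (n := 2) rfl =
      quadraticForm α β 0 rfl := hom_ext_chart fun V τ s ↦ by
    rw [comp_app_apply, τ.coord_linearForm, τ.coord_linearForm, τ.coord_quadraticForm, map_zero,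
      map_one]
    ring
  obtain ⟨y, hy⟩ := Ext.contravariant_sequence_exact₃ hT _
    ((Ext.mk₀ (linearForm α β (m := 1) (n := 2) rfl)).comp (classMap v) (zero_add 1)) (by
      refine Ext.biprod_ext ?_ ?_
      · rw [Ext.mk₀_comp_mk₀_assoc, Ext.mk₀_comp_mk₀_assoc]
        simp only [biprod.inl_desc, Ext.comp_zero]
        rw [hy]
        exact quadraticForm_comp_classMap (by linear_combination -h')
      · rw [Ext.mk₀_comp_mk₀_assoc, Ext.mk₀_comp_mk₀_assoc]
        simp only [biprod.inr_desc, Ext.comp_zero, Preadditive.neg_comp, Ext.mk₀_neg, Ext.neg_comp]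
        rw [hx, quadraticForm_comp_classMap (by linear_combination h), neg_zero]) (add_zero 1)
  obtain ⟨g, rfl⟩ := (Ext.mk₀_bijective _ _).2 y
  have hg : g = 0 := hom_eq_zero g
  rw [← hy, hg, Ext.mk₀_zero, Ext.comp_zero]

end ExtClass

/-! ### The middle terms -/

section Middle

variable {a b c : ℂ}

/-- The cubic form `α y ^ 3 + β x ^ 3`. -/
def cubicForm (α β : ℂ) {m n : ℤ} (h : n = m + 3) : O m ⟶ O n :=
  α • mulMonomial 0 3 (by simp [h]) + β • mulMonomial 3 0 (by simp [h])

lemma Chart.coord_cubicForm {V : P1.Opens} (τ : Chart V) (α β : ℂ) {m n : ℤ} (h : n = m + 3)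
    (s : Γ(O m, V)) : τ.coord n ((cubicForm α β h).app V s) =
      (const V α * τ.η ^ 3 + const V β * τ.ξ ^ 3) * τ.coord m s := by
  simp only [cubicForm, add_app_apply, map_add, τ.coord_hom_smul, τ.coord_mulMonomial]
  ring

lemma const_inv_mul (V : P1.Opens) {z : ℂ} (hz : z ≠ 0) : const V z⁻¹ * const V z = 1 := by
  rw [← map_mul, inv_mul_cancel₀ hz, map_one]

/-- If `b ^ 2 = a c`, there is a nonzero linear form `l` such that `x l` and `y l` are orthogonal
to the class. Together with the cube of a coordinate that does not vanish at the zero of `l`, it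
maps `𝒪(-1) ⊕ 𝒪(1)` onto `𝒪(2)`. -/
lemma exists_shortExact_linearForm (h : b ^ 2 - a * c = 0) :
    ∃ (j : O (-2) ⟶ O (-1) ⊞ O 1) (q : O (-1) ⊞ O 1 ⟶ O 2) (w : j ≫ q = 0),
      (ShortComplex.mk j q w).ShortExact ∧
        (Ext.mk₀ q).comp (classMap ![a, b, c]) (zero_add 1) = 0 := by
  obtain ⟨α, β, hαβ, h₁, h₂⟩ : ∃ α β : ℂ, (α ≠ 0 ∨ β ≠ 0) ∧ α * c - β * b = 0 ∧
      α * b - β * a = 0 := by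
    by_cases ha : a = 0
    · have hb : b = 0 := by simpa [ha] using h
      exact ⟨0, 1, .inr one_ne_zero, by simp [hb], by simp [ha]⟩
    · exact ⟨a, b, .inl ha, by linear_combination -h, by ring⟩
  -- the Bezout coefficients come from the divisibility of `(α x) ^ 3 + (β y) ^ 3` by `α x + β y`
  obtain ⟨γ, δ, H⟩ : ∃ γ δ : ℂ, ∀ (V : P1.Opens) (τ : Chart V), ∃ p q : Γ(P1, V),
      p * (const V α * τ.ξ + const V β * τ.η) + q * (const V γ * τ.η ^ 3 + const V δ * τ.ξ ^ 3)
        = 1 := by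
    obtain hα | hβ := hαβ
    · refine ⟨1, 0, fun V τ ↦ ?_⟩
      have e := const_inv_mul V hα
      obtain h₁ | h₁ := τ.eq_one
      · refine ⟨const V α⁻¹ ^ 3 * (const V α ^ 2 - const V α * const V β * τ.η +
          const V β ^ 2 * τ.η ^ 2), -const V α⁻¹ ^ 3 * const V β ^ 3, ?_⟩
        rw [h₁, map_one, map_zero]
        linear_combination (1 + const V α⁻¹ * const V α + (const V α⁻¹ * const V α) ^ 2) * e
      · exact ⟨0, 1, by simp [h₁]⟩
    · refine ⟨0, 1, fun V τ ↦ ?_⟩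
      have e := const_inv_mul V hβ
      obtain h₁ | h₁ := τ.eq_one
      · exact ⟨0, 1, by simp [h₁]⟩
      · refine ⟨const V β⁻¹ ^ 3 * (const V β ^ 2 - const V α * const V β * τ.ξ +
          const V α ^ 2 * τ.ξ ^ 2), -const V β⁻¹ ^ 3 * const V α ^ 3, ?_⟩
        rw [h₁, map_one, map_zero]
        linear_combination (1 + const V β⁻¹ * const V β + (const V β⁻¹ * const V β) ^ 2) * e
  refine ⟨biprod.lift (linearForm α β rfl) (cubicForm γ δ rfl),
    biprod.desc (cubicForm γ δ rfl) (-linearForm α β rfl), koszul_comp fun V τ ↦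
      ⟨_, _, τ.coord_linearForm _ _ _, τ.coord_cubicForm _ _ _, τ.coord_cubicForm _ _ _,
        τ.coord_linearForm _ _ _⟩, koszul_shortExact fun V τ ↦ ?_, ?_⟩
  · obtain ⟨p, q, e⟩ := H V τ
    exact ⟨_, _, p, q, e, τ.coord_linearForm _ _ _, τ.coord_cubicForm _ _ _,
      τ.coord_cubicForm _ _ _, τ.coord_linearForm _ _ _⟩
  · refine Ext.biprod_ext ?_ ?_
    · exact (ext_one_neg_one_neg_two_eq_zero _).trans (ext_one_neg_one_neg_two_eq_zero _).symm
    · rw [Ext.mk₀_comp_mk₀_assoc, biprod.inr_desc, Ext.mk₀_neg, Ext.neg_comp, Ext.comp_zero,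
        linearForm_comp_classMap h₁ h₂, neg_zero]

/-- If `b ^ 2 ≠ a c`, two quadratic forms that span the orthogonal complement of the class have no
common zeros, and map `𝒪 ⊕ 𝒪` onto `𝒪(2)`. -/
lemma exists_shortExact_quadraticForm (h : b ^ 2 - a * c ≠ 0) :
    ∃ (j : O (-2) ⟶ O 0 ⊞ O 0) (q : O 0 ⊞ O 0 ⟶ O 2) (w : j ≫ q = 0),
      (ShortComplex.mk j q w).ShortExact ∧
        (Ext.mk₀ q).comp (classMap ![a, b, c]) (zero_add 1) = 0 := by
  suffices ∃ α β γ α' β' γ' : ℂ, α * c - β * b + γ * a = 0 ∧ α' * c - β' * b + γ' * a = 0 ∧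
      ∀ (V : P1.Opens) (τ : Chart V), ∃ p q : Γ(P1, V),
        p * (const V α * τ.ξ ^ 2 + const V β * (τ.ξ * τ.η) + const V γ * τ.η ^ 2) +
          q * (const V α' * τ.ξ ^ 2 + const V β' * (τ.ξ * τ.η) + const V γ' * τ.η ^ 2) = 1 by
    obtain ⟨α, β, γ, α', β', γ', h₁, h₂, H⟩ := this
    refine ⟨biprod.lift (quadraticForm α β γ rfl) (quadraticForm α' β' γ' rfl),
      biprod.desc (quadraticForm α' β' γ' rfl) (-quadraticForm α β γ rfl), koszul_comp fun V τ ↦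
        ⟨_, _, τ.coord_quadraticForm _ _ _ _, τ.coord_quadraticForm _ _ _ _,
          τ.coord_quadraticForm _ _ _ _, τ.coord_quadraticForm _ _ _ _⟩,
      koszul_shortExact fun V τ ↦ ?_, ?_⟩
    · obtain ⟨p, q, e⟩ := H V τ
      exact ⟨_, _, p, q, e, τ.coord_quadraticForm _ _ _ _, τ.coord_quadraticForm _ _ _ _,
        τ.coord_quadraticForm _ _ _ _, τ.coord_quadraticForm _ _ _ _⟩
    · refine Ext.biprod_ext ?_ ?_
      · rw [Ext.mk₀_comp_mk₀_assoc, biprod.inl_desc, Ext.comp_zero, quadraticForm_comp_classMap h₂]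
      · rw [Ext.mk₀_comp_mk₀_assoc, biprod.inr_desc, Ext.mk₀_neg, Ext.neg_comp, Ext.comp_zero,
          quadraticForm_comp_classMap h₁, neg_zero]
  by_cases hb : b = 0
  · subst hb
    have ha : a ≠ 0 := by rintro rfl; simp at h
    have hc : c ≠ 0 := by rintro rfl; simp at h
    refine ⟨0, 1, 0, a, 0, -c, by ring, by ring, fun V τ ↦ ?_⟩
    have ea := const_inv_mul V ha
    have ec := const_inv_mul V hc
    simp only [map_neg, map_zero, map_one]
    obtain h₁ | h₁ := τ.eq_one <;> rw [h₁]
    · exact ⟨const V a⁻¹ * const V c * τ.η, const V a⁻¹, by linear_combination ea⟩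
    · exact ⟨const V c⁻¹ * const V a * τ.ξ, -const V c⁻¹, by linear_combination ec⟩
  · refine ⟨b, c, 0, 0, a, b, by ring, by ring, fun V τ ↦ ?_⟩
    -- the resultant of the two quadratic forms is `b ^ 2 * (b ^ 2 - a * c)`
    have e := const_inv_mul V (mul_ne_zero hb h)
    simp only [map_mul, map_sub, map_pow] at e
    simp only [map_zero]
    obtain h₁ | h₁ := τ.eq_one <;> rw [h₁]
    · refine ⟨-const V (b * (b ^ 2 - a * c))⁻¹ * (const V b * const V c * τ.η -
        (const V b ^ 2 - const V a * const V c)),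
        const V (b * (b ^ 2 - a * c))⁻¹ * const V c ^ 2, ?_⟩
      linear_combination e
    · refine ⟨const V (b * (b ^ 2 - a * c))⁻¹ * const V a ^ 2, -const V (b * (b ^ 2 - a * c))⁻¹ *
        (const V a * const V b * τ.ξ - (const V b ^ 2 - const V a * const V c)), ?_⟩
      linear_combination e

end Middle

/-- The isomorphism between `ℂ³` and `Ext¹(𝒪(2), 𝒪(-2))`. -/
def classEquiv : (Fin 3 → ℂ) ≃ₗ[ℂ] Ext (O 2) (O (-2)) 1 :=
  .ofBijective classMap ⟨classMap_injective, classMap_surjective⟩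

end

end
end P1Ext

theorem mainTheorem8 :
    ∃ Φ : (Fin 3 → ℂ) ≃ₗ[ℂ] Abelian.Ext (O 2) (O (-2)) 1, ∀ a b c : ℂ,
      Mono (presentation a b c) ∧
      (∃ h : (extensionSeq a b c).ShortExact, h.extClass = Φ ![a, b, c]) ∧
      ∀ (E : P1.Modules) (i : O (-2) ⟶ E) (p : E ⟶ O 2) (w : i ≫ p = 0)
        (h : (ShortComplex.mk i p w).ShortExact), h.extClass = Φ ![a, b, c] →
        ((a = 0 ∧ b = 0 ∧ c = 0) → Nonempty (E ≅ O (-2) ⊞ O 2)) ∧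
        (¬ (a = 0 ∧ b = 0 ∧ c = 0) → b ^ 2 - a * c = 0 → Nonempty (E ≅ O (-1) ⊞ O 1)) ∧
        (b ^ 2 - a * c ≠ 0 → Nonempty (E ≅ O 0 ⊞ O 0)) := by
  refine ⟨classEquiv, fun a b c ↦ ⟨?_, ?_, fun E i p w h hE ↦ ⟨?_, fun h₀ h₁ ↦ ?_, fun h₁ ↦ ?_⟩⟩⟩
  · rw [presentation_eq]
    exact mono_biprod_lift cubicSeq_shortExact _
  · let f := biproduct.desc ![a • 𝟙 (O (-2)), b • 𝟙 (O (-2)), c • 𝟙 (O (-2))]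
    have hf : f = scalarRow ![a, b, c] := desc_eq_scalarRow a b c
    refine ⟨pushoutSeq_shortExact cubicSeq_shortExact f,
      (pushoutSeq_extClass cubicSeq_shortExact f).trans ?_⟩
    rw [hf]
    rfl
  · rintro ⟨rfl, rfl, rfl⟩
    refine nonempty_iso_biprod_of_extClass_eq_zero h (hE.trans ?_)
    have : (![0, 0, 0] : Fin 3 → ℂ) = 0 := by ext i; fin_cases i <;> rfl
    rw [this, map_zero]
  · obtain ⟨j, q, w', hT, hq⟩ := exists_shortExact_linearForm h₁
    have hne : h.extClass ≠ 0 := by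
      rw [hE]
      intro h'
      have := (map_eq_zero_iff classEquiv classEquiv.injective).1 h'
      exact h₀ ⟨congrFun this 0, congrFun this 1, congrFun this 2⟩
    exact nonempty_iso_of_comp_extClass_eq_zero h exists_eq_smul_id hne hT
      ((congrArg (fun x ↦ (Abelian.Ext.mk₀ q).comp x (zero_add 1)) hE).trans hq)
  · obtain ⟨j, q, w', hT, hq⟩ := exists_shortExact_quadraticForm h₁
    have hne : h.extClass ≠ 0 := by
      rw [hE]
      intro h'
      have := (map_eq_zero_iff classEquiv classEquiv.injective).1 h'
      have ha : a = 0 := congrFun this 0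
      have hb : b = 0 := congrFun this 1
      exact h₁ (by simp [ha, hb])
    exact nonempty_iso_of_comp_extClass_eq_zero h exists_eq_smul_id hne hT
      ((congrArg (fun x ↦ (Abelian.Ext.mk₀ q).comp x (zero_add 1)) hE).trans hq)
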